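/- **Theorem (Identifiability of pairwise mean independent component analysis).** A random vector $s=(s_1,\dots,s_n)$ with integrable real coordinates is *pairwise mean independent* (PMI) if $\mathbb{E}(s_i\mid s_j)=\mathbb{E}(s_i)$ almost surely for all $i\neq j$. For a random vector $z$ in $\mathbb{R}^n$ with finite $d$-th absolute moments, let $\kappa_d(z)$ be its $d$-th cumulant tensor, $$\kappa_d(z)_{i_1\dots i_d}=\sum_{\pi}(-1)^{|\pi|-1}(|\pi|-1)!\prod_{B\in\pi}\mathbb{E}\Big(\prod_{k\in B}z_{i_k}\Big),$$ where $\pi$ runs over the partitions of $\{1,\dots,d\}$ and $|\pi|$ is the number of blocks. Let $$V_{\mathrm{pmi}}^{d,n}=\{T\in S^d(\mathbb{R}^n) : T_{ij\dots j}=0 \text{ for all } i\neq j\},$$ where $S^d(\mathbb{R}^n)$ is the space of real symmetric tensors of order $d$. If all $s_i$ have finite nonzero variance, write $\tilde s_i=(s_i-\mathbb{E}s_i)/\sqrt{\operatorname{Var}(s_i)}$ and $\tilde s=(\tilde s_1,\dots,\tilde s_n)$. Let $n\ge 0$ and $d\geq 3$ be integers. There is a polynomial $P=P_{n,d}$ with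 real coefficients in the entries of an order-$d$ tensor of format $n\times\cdots\times n$ such that: 1. $P$ does not vanish identically on $V_{\mathrm{pmi}}^{d,n}$, and there is a PMI random vector $s$ in $\mathbb{R}^n$, with coordinates of nonzero variance and finite $d$-th absolute moments, for which $P(\kappa_d(\tilde s))\neq 0$. 2. Let $s$ be any PMI random vector in $\mathbb{R}^n$ whose coordinates have nonzero variance and finite $d$-th absolute moments, and suppose that $P(\kappa_d(\tilde s))\neq 0$ (that is, $s$ is sufficiently general). Let $A\in\mathbb{R}^{n\times n}$ be invertible and $x=As$. Then $A$ is identifiable from the distribution of $x$, up to permutation and scaling of columns: if $s'$ is any PMI random vector (possibly on another probability space) and $B\in\mathbb{R}^{n\times n}$ is any invertible matrix such that $Bs'$ and $As$ have the same distribution, then there are a permutation $\sigma$ of $\{1,\dots,n\}$ and nonzero real numbers $c_1,\dots,c_n$ such that, for every $j$, column $\sigma(j)$ of $B$ equals $c_j$ times column $j$ of $A$. -/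

import Mathlib

open MeasureTheory ProbabilityTheory

noncomputable section

/-- The order-`d` cumulant tensor `κ_d(z)` of a random vector `z` in `ℝⁿ` under `μ`, by the
cumulant-moment relation: the `(i_1, …, i_d)` entry is the sum over all partitions `π` of
`{1, …, d}` of `(-1)^(|π| - 1) (|π| - 1)! ∏_{B ∈ π} 𝔼 (∏_{k ∈ B} z_{i_k})`.
It is meaningful as soon as the coordinates of `z` have finite `d`-th absolute moments. -/
def cumulantTensor {Ω : Type*} [MeasurableSpace Ω] {n : ℕ} (μ : Measure Ω)
    (z : Ω → Fin n → ℝ) (d : ℕ) (idx : Fin d → Fin n) : ℝ :=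
  ∑ π : Finpartition (Finset.univ : Finset (Fin d)),
    (-1 : ℝ) ^ (π.parts.card - 1) * (Nat.factorial (π.parts.card - 1) : ℝ) *
      ∏ B ∈ π.parts, ∫ ω, ∏ k ∈ B, z ω (idx k) ∂μ

/-- The space `V_pmi` of real symmetric tensors of format `n × ⋯ × n` (`d` times) all of whose
entries `T_{i j ⋯ j}` with `i ≠ j` vanish (the index `i` may sit at any position `k`, which by
symmetry is the same condition). -/
def Vpmi (d n : ℕ) : Set ((Fin d → Fin n) → ℝ) :=
  {T | (∀ (σ : Equiv.Perm (Fin d)) (idx : Fin d → Fin n), T (idx ∘ σ) = T idx) ∧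
    ∀ (k : Fin d) (i j : Fin n), i ≠ j → T (Function.update (fun _ => j) k i) = 0}

/-- Pairwise mean independence of a random vector with integrable coordinates:
`𝔼 (z_i | z_j) = 𝔼 (z_i)` almost surely, for all `i ≠ j`. -/
def PairwiseMeanIndep {Ω : Type*} [MeasurableSpace Ω] {n : ℕ} (μ : Measure Ω)
    (z : Ω → Fin n → ℝ) : Prop :=
  (∀ i, Integrable (fun ω => z ω i) μ) ∧
    ∀ i j, i ≠ j →
      μ[fun ω => z ω i | MeasurableSpace.comap (fun ω => z ω j) inferInstance]
        =ᵐ[μ] fun _ => ∫ ω, z ω i ∂μ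

/-- The coordinatewise standardization of a random vector: every coordinate is shifted to mean
zero and scaled to variance one. For uncorrelated coordinates with nonzero variances this is the
whitening of `z`. -/
def standardize {Ω : Type*} [MeasurableSpace Ω] {n : ℕ} (μ : Measure Ω)
    (z : Ω → Fin n → ℝ) : Ω → Fin n → ℝ :=
  fun ω i => (z ω i - ∫ ω', z ω' i ∂μ) / Real.sqrt (variance (fun ω' => z ω' i) μ)

/-- Admissible sources for cumulants of order `d`: a measurable pairwise mean independent random
vector whose coordinates are non-degenerate and have finite `d`-th absolute moments. -/
structure IsPMISource {Ω : Type*} [MeasurableSpace Ω] {n : ℕ} (μ : Measure Ω)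
    (d : ℕ) (s : Ω → Fin n → ℝ) : Prop where
  measurable : Measurable s
  pmi : PairwiseMeanIndep μ s
  memLp : ∀ i, MemLp (fun ω => s ω i) (d : ENNReal) μ
  variance_ne_zero : ∀ i, variance (fun ω => s ω i) μ ≠ 0

end

/-!
If `B s'` and `A s` have the same law, then, up to standardization, `s'` has the law of `Q s` with
`Q` orthogonal, because both covariance matrices are diagonal. Since the cumulants of `s'` satisfy
`κ_{ij⋯j} = 0` for `i ≠ j`, the rows of `Q` form an orthonormal basis of eigenvectors of the tensor
`κ_d(s̃)`. So it suffices that a generic `T ∈ V_pmi` has no orthonormal eigenbasis other than the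
standard one, up to signs and order. This is a dimension count: for a fixed vector `u`, or
orthogonal pair `u, v`, with enough nonzero coordinates, being eigenvectors imposes on `T` as many
independent linear conditions as there are parameters for `u`, or for `u` and `v`, and one equation
more must hold. For `d ≥ 4` it is the orthogonality `⟨u, v⟩ = 0`. For `d = 3` it says that the
eigenvalue of `u` is `∑ T_{jjj} u_j`, which follows by contracting two indices of `T` with the
orthonormal eigenbasis.

Sources reach generic tensors because the uniform distribution on a product grid can be perturbed,
preserving pairwise mean independence and all moments of order less than `d`, so as to move its
`d`-th cumulant tensor by any small element of `V_pmi`.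
-/

section Elimination

open MvPolynomial

variable {K : Type*} [Field K]

/-- The matrix `det N • 1 - E * adj N * M`, where `N` consists of the columns of `M` selected by `J`
and `E` is the corresponding coordinate inclusion. It acts on the kernel of `M` as multiplication by
`det N` and ignores the coordinates selected by `J`, so that it recovers an element of the kernel
from its remaining coordinates without dividing by `det N`. -/
def kernelProjector {κ β R : Type*} [Fintype κ] [DecidableEq κ] [Fintype β] [DecidableEq β]
    [CommRing R] (M : Matrix κ β R) (J : κ → β) : Matrix β β R :=
  (M.submatrix id J).det • 1 -
    (1 : Matrix β β R).submatrix id J * (M.submatrix id J).adjugate * M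

namespace kernelProjector

variable {κ β R : Type*} [Fintype κ] [DecidableEq κ] [Fintype β] [DecidableEq β] [CommRing R]

theorem mulVec_of_mulVec_eq_zero {M : Matrix κ β R} (J : κ → β) {x : β → R}
    (hx : M.mulVec x = 0) :
    (kernelProjector M J).mulVec x = (M.submatrix id J).det • x := by
  rw [kernelProjector, Matrix.sub_mulVec, ← Matrix.mulVec_mulVec, hx, Matrix.mulVec_zero, sub_zero,
    Matrix.smul_mulVec, Matrix.one_mulVec]

theorem apply_range (M : Matrix κ β R) (J : κ → β) (i : β) (k : κ) :
    kernelProjector M J i (J k) = 0 := by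
  suffices h : (kernelProjector M J).submatrix id J = 0 from congr_fun₂ h i k
  set N := M.submatrix id J
  calc (kernelProjector M J).submatrix id J
      = N.det • (1 : Matrix β β R).submatrix id J
          - (1 : Matrix β β R).submatrix id J * (N.adjugate * N) := by
        rw [← Matrix.mul_assoc]; rfl
    _ = 0 := by rw [Matrix.adjugate_mul, Matrix.mul_smul, Matrix.mul_one, sub_self]

theorem sum_mul_of_mulVec_eq_zero {M : Matrix κ β R} (J : κ → β) {x : β → R}
    [Fintype {i // i ∉ Set.range J}] (hx : M.mulVec x = 0) (i : β) :
    ∑ c : {i // i ∉ Set.range J}, kernelProjector M J i c * x c =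
      (M.submatrix id J).det * x i := by
  refine Eq.trans ?_ (congr_fun (mulVec_of_mulVec_eq_zero J hx) i)
  refine Fintype.sum_of_injective Subtype.val Subtype.val_injective _ _ (fun c hc => ?_)
    fun _ => rfl
  obtain ⟨k, rfl⟩ : c ∈ Set.range J := by simpa using hc
  exact mul_eq_zero_of_left (apply_range M J i k) _

theorem map {S : Type*} [CommRing S] (f : R →+* S) (M : Matrix κ β R) (J : κ → β) :
    (kernelProjector M J).map f = kernelProjector (M.map f) J := by
  have hadj : (M.submatrix id J).adjugate.map f = ((M.map f).submatrix id J).adjugate :=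
    f.map_adjugate _
  have hdet : f (M.submatrix id J).det = ((M.map f).submatrix id J).det := f.map_det _
  have hone : ((1 : Matrix β β R).submatrix id J).map f = (1 : Matrix β β S).submatrix id J := by
    rw [← Matrix.submatrix_map, Matrix.map_one f f.map_zero f.map_one]
  rw [kernelProjector, kernelProjector, ← hadj, ← hdet, ← hone, ← Matrix.map_mul, ← Matrix.map_mul,
    Matrix.map_sub f f.map_sub, Matrix.map_smul' f _ _ f.map_mul,
    Matrix.map_one f f.map_zero f.map_one]

end kernelProjector

theorem exists_det_submatrix_ne_zero_of_linearIndependent_row {κ β : Type*} [Fintype κ]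
    [DecidableEq κ] [Finite β] {M : Matrix κ β K} (hM : LinearIndependent K M.row) :
    ∃ J : κ → β, Function.Injective J ∧ (M.submatrix id J).det ≠ 0 := by
  have := Fintype.ofFinite β
  obtain ⟨κ', a, ha, hspan, hli⟩ := exists_linearIndependent' K M.col
  have : Fintype κ' := Fintype.ofInjective a ha
  have hcard : Fintype.card κ = Fintype.card κ' := by
    rw [← hM.rank_matrix, Matrix.rank_eq_finrank_span_cols, ← hspan, finrank_span_eq_card hli]
  let e : κ ≃ κ' := Fintype.equivOfCardEq hcard
  refine ⟨a ∘ e, ha.comp e.injective, ?_⟩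
  have hcol : LinearIndependent K (M.submatrix id (a ∘ e)).col := hli.comp e e.injective
  exact ((Matrix.isUnit_iff_isUnit_det _).mp
    (Matrix.linearIndependent_cols_iff_isUnit.mp hcol)).ne_zero

/-- Either `F` is algebraically dependent, or it is a transcendence basis, over which `R` is
algebraic; a multiple of `R` is then a polynomial in `F`. -/
theorem exists_relation_on_zeroLocus {β τ : Type*} [Fintype β] [Fintype τ]
    (hcard : Fintype.card τ ≤ Fintype.card β) (F : β → MvPolynomial τ K)
    {R : MvPolynomial τ K} (hR : R ≠ 0) :
    ∃ G : MvPolynomial β K, G ≠ 0 ∧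
      ∀ q : τ → K, eval q R = 0 → eval (fun i => eval q (F i)) G = 0 := by
  have eval_aeval (q : τ → K) (G : MvPolynomial β K) :
      eval q (aeval F G) = eval (fun i => eval q (F i)) G := by
    simp only [← aeval_eq_eval]
    exact aeval_bind₁ _ _ _
  by_cases hF : AlgebraicIndependent K F
  · have hbasis : IsTranscendenceBasis K F := by
      refine hF.isTranscendenceBasis_of_lift_trdeg_le_of_finite ?_
      rw [MvPolynomial.trdeg_of_isDomain]
      simpa using hcard
    have := hbasis.isAlgebraic
    obtain ⟨⟨r, hr⟩, hr0, S, hS⟩ :=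
      (Algebra.IsAlgebraic.isAlgebraic (R := Algebra.adjoin K (Set.range F)) R).exists_nonzero_dvd
        (mem_nonZeroDivisors_of_ne_zero hR)
    rw [Algebra.adjoin_range_eq_range_aeval] at hr
    obtain ⟨G, rfl⟩ := hr
    refine ⟨G, ?_, fun q hq => ?_⟩
    · rintro rfl
      exact hr0 (Subtype.ext (map_zero (aeval F)))
    · have hGRS : aeval F G = R * S := hS
      rw [← eval_aeval, hGRS, map_mul, hq, zero_mul]
  · rw [algebraicIndependent_iff] at hF
    push Not at hF
    obtain ⟨G, hG, hG0⟩ := hF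
    exact ⟨G, hG0, fun q _ => by rw [← eval_aeval, hG, map_zero]⟩

theorem exists_polynomial_of_det_submatrix_ne_zero {ι κ β : Type*} [Fintype ι] [Fintype κ]
    [DecidableEq κ] [Fintype β] (hcard : Fintype.card ι ≤ Fintype.card κ)
    (M : Matrix κ β (MvPolynomial ι K)) {R : MvPolynomial ι K} (hR : R ≠ 0)
    {J : κ → β} (hJ : Function.Injective J) :
    ∃ G : MvPolynomial β K, G ≠ 0 ∧ ∀ (p : ι → K) (x : β → K), eval p R = 0 →
      (M.map (eval p)).mulVec x = 0 → ((M.map (eval p)).submatrix id J).det ≠ 0 →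
      eval x G = 0 := by
  classical
  let free := {i // i ∉ Set.range J}
  let F (i : β) : MvPolynomial (ι ⊕ free) K :=
    ∑ c : free, rename Sum.inl (kernelProjector M J i c) * X (Sum.inr c)
  have hcard' : Fintype.card (ι ⊕ free) ≤ Fintype.card β := by
    have hfree : Fintype.card free = Fintype.card β - Fintype.card κ := by
      rw [← Set.card_range_of_injective hJ]
      exact Fintype.card_compl_set (Set.range J)
    have hle := Fintype.card_le_of_injective J hJ
    rw [Fintype.card_sum, hfree]
    omega
  have hR' : (rename Sum.inl R : MvPolynomial (ι ⊕ free) K) ≠ 0 := by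
    simpa using (rename_injective _ Sum.inl_injective).ne hR
  obtain ⟨G, hG0, hG⟩ := exists_relation_on_zeroLocus hcard' F hR'
  refine ⟨G, hG0, fun p x hp hx hdet => ?_⟩
  set Δ := ((M.map (eval p)).submatrix id J).det
  let q : ι ⊕ free → K := Sum.elim p fun c => Δ⁻¹ * x c
  have eval_rename_inl (f : MvPolynomial ι K) : eval q (rename Sum.inl f) = eval p f := by
    rw [eval_rename]; rfl
  have hFx : (fun i => eval q (F i)) = x := by
    ext i
    calc eval q (F i)
        = Δ⁻¹ * ∑ c : free, kernelProjector (M.map (eval p)) J i c * x c := by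
          rw [← kernelProjector.map, Finset.mul_sum, map_sum]
          refine Finset.sum_congr rfl fun c _ => ?_
          rw [map_mul, eval_rename_inl, eval_X, Matrix.map_apply]
          exact mul_left_comm _ _ _
      _ = x i := by
          rw [kernelProjector.sum_mul_of_mulVec_eq_zero J hx, inv_mul_cancel_left₀ hdet]
  have := hG q (by rw [eval_rename_inl, hp])
  rwa [hFx] at this

theorem exists_polynomial_of_linearIndependent_row {ι κ β : Type*} [Fintype ι] [Fintype κ]
    [Fintype β] (hcard : Fintype.card ι ≤ Fintype.card κ) (M : Matrix κ β (MvPolynomial ι K))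
    {R : MvPolynomial ι K} (hR : R ≠ 0) :
    ∃ G : MvPolynomial β K, G ≠ 0 ∧ ∀ (p : ι → K) (x : β → K), eval p R = 0 →
      (M.map (eval p)).mulVec x = 0 → LinearIndependent K (M.map (eval p)).row →
      eval x G = 0 := by
  classical
  choose G hG0 hG using fun J : κ ↪ β =>
    exists_polynomial_of_det_submatrix_ne_zero hcard M hR J.injective
  refine ⟨∏ J, G J, Finset.prod_ne_zero_iff.mpr fun J _ => hG0 J, fun p x hp hx hli => ?_⟩
  obtain ⟨J, hJ, hdet⟩ := exists_det_submatrix_ne_zero_of_linearIndependent_row hli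
  rw [map_prod]
  exact Finset.prod_eq_zero (Finset.mem_univ ⟨J, hJ⟩) (hG ⟨J, hJ⟩ p x hp hx hdet)

theorem exists_polynomial_eval_lineMap {σ : Type*} (P : MvPolynomial σ K) (T T' : σ → K) :
    ∃ Q : Polynomial K, ∀ t : K, Q.eval t = eval (AffineMap.lineMap T T' t) P := by
  refine ⟨aeval (fun i => Polynomial.X * Polynomial.C (T' i - T i) + Polynomial.C (T i)) P,
    fun t => ?_⟩
  rw [← Polynomial.coe_aeval_eq_eval, ← AlgHom.comp_apply, comp_aeval, ← coe_aeval_eq_eval,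
    RingHom.coe_coe]
  congr 2
  funext i
  simp [AffineMap.lineMap_apply]

theorem exists_polynomial_coordinates {σ : Type*} [Finite σ] (W : Submodule K (σ → K)) :
    ∃ ℓ : Fin (Module.finrank K W) → MvPolynomial σ K, ∀ (w : W) (G : MvPolynomial _ K),
      eval (w : σ → K) (bind₁ ℓ G) = eval ((Module.finBasis K W).equivFun w) G := by
  classical
  have := Fintype.ofFinite σ
  obtain ⟨f, hf⟩ := (Module.finBasis K W).equivFun.toLinearMap.exists_extend
  refine ⟨f.toMatrix'.toMvPolynomial, fun w G => ?_⟩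
  have hw : (Module.finBasis K W).equivFun w = f w := (LinearMap.congr_fun hf w).symm
  have hcoord (i) : eval (w : σ → K) (f.toMatrix'.toMvPolynomial i) = f w i := by
    rw [Matrix.toMvPolynomial_eval_eq_apply, LinearMap.toMatrix'_mulVec]
  simp only [hw, ← aeval_eq_eval, aeval_bind₁] at hcoord ⊢
  exact congr_arg (fun x => aeval x G) (funext hcoord)

variable [Infinite K]

/-- The filter of properties that hold on a nonempty Zariski-open subset of a linear subspace `W` of
`σ → K`: this is what *for generic elements of `W`* means. -/
def zariskiGeneric {σ : Type*} (W : Submodule K (σ → K)) : Filter (σ → K) where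
  sets := {S | ∃ P : MvPolynomial σ K, (∃ T ∈ W, eval T P ≠ 0) ∧ ∀ T ∈ W, eval T P ≠ 0 → T ∈ S}
  univ_sets := ⟨1, ⟨0, W.zero_mem, by simp⟩, fun _ _ _ => Set.mem_univ _⟩
  sets_of_superset := by
    rintro S S' ⟨P, hP, hPS⟩ hS
    exact ⟨P, hP, fun T hT hTP => hS (hPS T hT hTP)⟩
  inter_sets := by
    rintro S S' ⟨P, ⟨T, hT, hTP⟩, hPS⟩ ⟨P', ⟨T', hT', hTP'⟩, hPS'⟩
    obtain ⟨Q, hQ⟩ := exists_polynomial_eval_lineMap P T T'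
    obtain ⟨Q', hQ'⟩ := exists_polynomial_eval_lineMap P' T T'
    have hne : Q * Q' ≠ 0 := by
      refine mul_ne_zero ?_ ?_
      · rintro rfl
        exact hTP (by simpa using (hQ 0).symm)
      · rintro rfl
        exact hTP' (by simpa using (hQ' 1).symm)
    obtain ⟨t, ht⟩ : ∃ t : K, (Q * Q').eval t ≠ 0 := by
      contrapose! hne
      exact Polynomial.funext (by simpa using hne)
    have hmem : AffineMap.lineMap T T' t ∈ W :=
      W.add_mem (W.smul_mem t (W.sub_mem hT' hT)) hT
    rw [Polynomial.eval_mul, hQ, hQ', ← map_mul] at ht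
    refine ⟨P * P', ⟨_, hmem, ht⟩, fun T hT h => ?_⟩
    rw [map_mul] at h
    exact ⟨hPS T hT (left_ne_zero_of_mul h), hPS' T hT (right_ne_zero_of_mul h)⟩

theorem eventually_zariskiGeneric_mem {σ : Type*} (W : Submodule K (σ → K)) :
    ∀ᶠ T in zariskiGeneric W, T ∈ W :=
  ⟨1, ⟨0, W.zero_mem, by simp⟩, fun _ hT _ => hT⟩

/-- The dimension count: the pairs `(p, T)` with `R p = 0` and `Φ k T p = 0` for all `k`, with
independent conditions on `T`, form a set of dimension less than `card ι + (dim W - card κ)`. -/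
theorem eventually_exists_linear_relation {σ ι κ : Type*} [Finite σ] [Fintype ι] [Fintype κ]
    (W : Submodule K (σ → K)) (hcard : Fintype.card ι ≤ Fintype.card κ)
    (Φ : κ → (σ → K) →ₗ[K] MvPolynomial ι K) {R : MvPolynomial ι K} (hR : R ≠ 0) :
    ∀ᶠ T in zariskiGeneric W, ∀ p : ι → K, eval p R = 0 → (∀ k, eval p (Φ k T) = 0) →
      ∃ c : κ → K, c ≠ 0 ∧ ∀ S ∈ W, ∑ k, c k * eval p (Φ k S) = 0 := by
  let b := Module.finBasis K W
  obtain ⟨G, hG0, hG⟩ := exists_polynomial_of_linearIndependent_row hcard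
    (Matrix.of fun k i => Φ k (b i : σ → K)) hR
  obtain ⟨ℓ, hℓ⟩ := exists_polynomial_coordinates W
  have eval_sum_basis (p : ι → K) (S : W) (k : κ) :
      eval p (Φ k S) = ∑ i, eval p (Φ k (b i : σ → K)) * b.equivFun S i := by
    conv_lhs => rw [← b.sum_equivFun S]
    simp only [Submodule.coe_sum, Submodule.coe_smul, map_sum, map_smul, smul_eval, mul_comm]
  refine ⟨bind₁ ℓ G, ?_, fun T hT hTG p hp hΦ => ?_⟩
  · obtain ⟨x, hx⟩ : ∃ x, eval x G ≠ 0 := by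
      contrapose! hG0
      exact MvPolynomial.funext (by simpa using hG0)
    refine ⟨_, (b.equivFun.symm x).2, ?_⟩
    rwa [hℓ, LinearEquiv.apply_symm_apply]
  · by_contra! hind
    rw [hℓ ⟨T, hT⟩] at hTG
    refine hTG (hG p _ hp (funext fun k => ?_) (Fintype.linearIndependent_iff.mpr fun c hc => ?_))
    · exact (eval_sum_basis p ⟨T, hT⟩ k).symm.trans (hΦ k)
    · refine congr_fun (not_not.mp fun hc0 => ?_)
      obtain ⟨S, hS, hne⟩ := hind c hc0
      refine hne ?_
      simp only [eval_sum_basis p ⟨S, hS⟩, Finset.mul_sum]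
      rw [Finset.sum_comm]
      refine Finset.sum_eq_zero fun i _ => ?_
      have hci : ∑ k, c k * eval p (Φ k (b i : σ → K)) = 0 := by
        simpa using congr_fun hc i
      simp only [← mul_assoc, ← Finset.sum_mul, hci, zero_mul]

end Elimination

section Tensors

variable {n d e : ℕ}

/-- The contraction `T u^e`, i.e. the vector with entries `T(e_j, u, …, u)`, of a tensor `T` of
order `e + 1`. The entries of `u` may lie in any `ℝ`-algebra, so that `u` may be generic. -/
noncomputable def contractPow {S : Type*} [CommRing S] [Algebra ℝ S] (u : Fin n → S) :
    ((Fin (e + 1) → Fin n) → ℝ) →ₗ[ℝ] Fin n → S where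
  toFun T j := ∑ idx : Fin e → Fin n, T (Fin.cons j idx) • ∏ k, u (idx k)
  map_add' T T' := by ext; simp [add_smul, Finset.sum_add_distrib]
  map_smul' c T := by ext; simp [Finset.smul_sum, mul_smul]

theorem contractPow_apply {S : Type*} [CommRing S] [Algebra ℝ S] (u : Fin n → S)
    (T : (Fin (e + 1) → Fin n) → ℝ) (j : Fin n) :
    contractPow u T j = ∑ idx : Fin e → Fin n, T (Fin.cons j idx) • ∏ k, u (idx k) := rfl

theorem eval_contractPow {ι : Type*} (p : ι → ℝ) (U : Fin n → MvPolynomial ι ℝ)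
    (T : (Fin (e + 1) → Fin n) → ℝ) (j : Fin n) :
    MvPolynomial.eval p (contractPow U T j) =
      contractPow (fun i => MvPolynomial.eval p (U i)) T j := by
  simp only [contractPow_apply, map_sum, MvPolynomial.smul_eval, map_prod, smul_eq_mul]

theorem contractPow_smul (c : ℝ) (u : Fin n → ℝ) (T : (Fin (e + 1) → Fin n) → ℝ) :
    contractPow (c • u) T = c ^ e • contractPow u T := by
  ext j
  simp only [contractPow_apply, Pi.smul_apply, smul_eq_mul, Finset.prod_mul_distrib,
    Finset.prod_const, Finset.card_univ, Fintype.card_fin, Finset.mul_sum]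
  exact Finset.sum_congr rfl fun _ _ => mul_left_comm _ _ _

/-- `Vpmi d n` as a linear subspace. -/
def VpmiSubmodule (d n : ℕ) : Submodule ℝ ((Fin d → Fin n) → ℝ) where
  carrier := Vpmi d n
  zero_mem' := ⟨fun _ _ => rfl, fun _ _ _ _ => rfl⟩
  add_mem' h h' := ⟨fun σ idx => by simp [h.1 σ idx, h'.1 σ idx],
    fun k i j hij => by simp [h.2 k i j hij, h'.2 k i j hij]⟩
  smul_mem' c T h := ⟨fun σ idx => by simp [h.1 σ idx], fun k i j hij => by simp [h.2 k i j hij]⟩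

theorem VpmiSubmodule.apply_cons_const {T : (Fin (e + 1) → Fin n) → ℝ}
    (hT : T ∈ VpmiSubmodule (e + 1) n) {i j : Fin n} (hij : i ≠ j) :
    T (Fin.cons i fun _ => j) = 0 := by
  rw [← hT.2 0 i j hij]
  congr 1
  ext k
  cases k using Fin.cases <;> rfl

/-- The number of occurrences of each value of an index tuple `(i_1, …, i_d)`: the exponent of the
monomial `x_{i_1} ⋯ x_{i_d}`. -/
noncomputable def indexCount (idx : Fin d → Fin n) : Fin n →₀ ℕ :=
  ∑ k, Finsupp.single (idx k) 1

theorem indexCount_cons (j : Fin n) (idx : Fin d → Fin n) :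
    indexCount (Fin.cons j idx : Fin (d + 1) → Fin n) = Finsupp.single j 1 + indexCount idx := by
  simp only [indexCount, Fin.sum_univ_succ, Fin.cons_zero, Fin.cons_succ]

theorem indexCount_const (d : ℕ) (j : Fin n) :
    indexCount (fun _ : Fin d => j) = Finsupp.single j d := by
  simp [indexCount]

theorem indexCount_comp_perm (idx : Fin d → Fin n) (σ : Equiv.Perm (Fin d)) :
    indexCount (idx ∘ σ) = indexCount idx :=
  Equiv.sum_comp σ fun k => Finsupp.single (idx k) 1

/-- The symmetric tensor whose entries are `1` at the rearrangements of the index tuple with counts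
`β`, and `0` elsewhere. -/
noncomputable def monomialTensor (d : ℕ) (β : Fin n →₀ ℕ) : (Fin d → Fin n) → ℝ :=
  fun idx => if indexCount idx = β then 1 else 0

theorem monomialTensor_mem {β : Fin n →₀ ℕ} (hβ : ∀ j, β j ≠ e) :
    monomialTensor (e + 1) β ∈ VpmiSubmodule (e + 1) n := by
  refine ⟨fun σ idx => by rw [monomialTensor, monomialTensor, indexCount_comp_perm],
    fun k i j hij => if_neg fun h => hβ j ?_⟩
  rw [← h, indexCount, Finsupp.finsetSum_apply]
  have hcount (l : Fin (e + 1)) :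
      Finsupp.single (Function.update (fun _ => j) k i l) 1 j = if l = k then 0 else 1 := by
    by_cases hl : l = k <;> simp [hl, hij]
  simp [hcount, Finset.sum_ite, Finset.filter_ne']

theorem monomialTensor_single_mem (he : e ≠ 0) (c : Fin n) :
    monomialTensor (e + 1) (Finsupp.single c (e + 1)) ∈ VpmiSubmodule (e + 1) n :=
  monomialTensor_mem fun j => by rw [Finsupp.single_apply]; split_ifs <;> omega

theorem monomialTensor_triple_mem {k : ℕ} {a b c : Fin n} (hab : a ≠ b) (hac : a ≠ c)
    (hbc : b ≠ c) (hk : k ≠ 0) :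
    monomialTensor (k + 2) (Finsupp.single a k + Finsupp.single b 1 + Finsupp.single c 1) ∈
      VpmiSubmodule (k + 2) n :=
  monomialTensor_mem fun j => by
    simp only [Finsupp.add_apply, Finsupp.single_apply]
    grind

open MvPolynomial in
theorem contractPow_monomialTensor (u : Fin n → ℝ) (β : Fin n →₀ ℕ) (j : Fin n) :
    contractPow u (monomialTensor (e + 1) β) j = coeff β (X j * (∑ i, u i • X i) ^ e) := by
  have hexpand : X j * (∑ i, u i • X i : MvPolynomial (Fin n) ℝ) ^ e
      = ∑ idx : Fin e → Fin n, monomial (indexCount (Fin.cons j idx : Fin (e + 1) → Fin n))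
          (∏ k, u (idx k)) := by
    rw [← Fin.prod_const, Fintype.prod_sum, Finset.mul_sum]
    refine Finset.sum_congr rfl fun idx _ => ?_
    rw [indexCount_cons, indexCount]
    simp only [X, smul_monomial, smul_eq_mul, mul_one, ← monomial_sum_prod, monomial_mul, one_mul]
  rw [hexpand, coeff_sum, contractPow_apply]
  refine Finset.sum_congr rfl fun idx _ => ?_
  rw [coeff_monomial, monomialTensor, smul_eq_mul, ite_mul, one_mul, zero_mul]

section TestTensors

open MvPolynomial

variable {R σ : Type*} [CommSemiring R] [Fintype σ]

theorem coeff_sum_smul_X_pow_pair (u : σ → R) {a b : σ} (hab : a ≠ b) (k l : ℕ) :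
    coeff (Finsupp.single a k + Finsupp.single b l) ((∑ i, u i • X i) ^ (k + l)) =
      (k + l).choose k * (u a ^ k * u b ^ l) := by
  classical
  set s := Finsupp.single a k + Finsupp.single b l with hs
  have hsupp : s.support ⊆ {a, b} := by
    refine Finsupp.support_add.trans (Finset.union_subset ?_ ?_) <;>
      exact Finsupp.support_single_subset.trans (by simp)
  have hsa : s a = k := by simp [hs, hab]
  have hsb : s b = l := by simp [hs, hab.symm]
  rw [coeff_linearCombination_X_pow_of_fintype, Finsupp.sum_of_support_subset s hsupp _ (by simp),
    Finset.sum_pair hab, hsa, hsb, if_pos rfl, ← Finsupp.multinomial_of_support_subset hsupp,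
    Nat.binomial_eq_choose hab, Finsupp.prod_of_support_subset s hsupp _ (by simp),
    Finset.prod_pair hab, hsa, hsb]

theorem coeff_sum_smul_X_pow_eq_zero {u : σ → R} {c : σ} (hc : u c = 0) {s : σ →₀ ℕ}
    (hs : s c ≠ 0) (m : ℕ) :
    coeff s ((∑ i, u i • X i : MvPolynomial σ R) ^ m) = 0 := by
  rw [coeff_linearCombination_X_pow_of_fintype]
  have hprod : (s.prod fun i k => u i ^ k) = 0 :=
    Finset.prod_eq_zero (Finsupp.mem_support_iff.mpr hs) (by simp [hc, hs])
  simp only [hprod, mul_zero, ite_self]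

variable (u : Fin n → ℝ)

theorem contractPow_monomialTensor_power (e : ℕ) (j : Fin n) :
    contractPow u (monomialTensor (e + 1) (Finsupp.single j (e + 1))) = Pi.single j (u j ^ e) := by
  ext i
  rw [contractPow_monomialTensor, coeff_X_mul']
  by_cases hij : i = j
  · subst hij
    rw [if_pos (by simp), Finsupp.single_add, add_tsub_cancel_right,
      coeff_linearCombination_X_pow_of_fintype]
    have hmult : (Finsupp.single i e).multinomial = 1 := by
      rw [← Finsupp.multinomial_of_support_subset (s := {i}) Finsupp.support_single_subset,
        Nat.multinomial_singleton]
    simp [hmult]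
  · simp [hij]

theorem contractPow_monomialTensor_sq (k : ℕ) {a b : Fin n} (hab : a ≠ b) :
    contractPow u (monomialTensor (k + 3) (Finsupp.single a (k + 1) + Finsupp.single b 2)) =
      Pi.single a ((k + 2).choose 2 * (u a ^ k * u b ^ 2)) +
        Pi.single b ((k + 2) * (u a ^ (k + 1) * u b)) := by
  ext i
  rw [contractPow_monomialTensor, coeff_X_mul', Pi.add_apply]
  by_cases hia : i = a
  · subst hia
    rw [if_pos (by simp), Finsupp.single_add, add_right_comm, add_tsub_cancel_right,
      coeff_sum_smul_X_pow_pair u hab, Nat.choose_symm_add]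
    simp [hab]
  by_cases hib : i = b
  · subst hib
    have hsub : Finsupp.single a (k + 1) + Finsupp.single i 2 - Finsupp.single i 1 =
        Finsupp.single a (k + 1) + Finsupp.single i 1 := by
      rw [← one_add_one_eq_two, Finsupp.single_add i, ← add_assoc, add_tsub_cancel_right]
    rw [if_pos (by simp), hsub, coeff_sum_smul_X_pow_pair u hab]
    rw [Pi.single_eq_of_ne hia, Pi.single_eq_same, Nat.choose_succ_self_right]
    push_cast
    ring
  · simp [hia, hib]

theorem contractPow_monomialTensor_mul (k : ℕ) {a b c : Fin n} (hab : a ≠ b) (hac : a ≠ c)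
    (hbc : b ≠ c) (hc : u c = 0) :
    contractPow u (monomialTensor (k + 2)
        (Finsupp.single a k + Finsupp.single b 1 + Finsupp.single c 1)) =
      Pi.single c ((k + 1) * (u a ^ k * u b)) := by
  ext i
  rw [contractPow_monomialTensor, coeff_X_mul']
  by_cases hic : i = c
  · subst hic
    rw [if_pos (by simp), add_tsub_cancel_right, coeff_sum_smul_X_pow_pair u hab]
    simp
  · rw [Pi.single_eq_of_ne hic]
    split_ifs
    · refine coeff_sum_smul_X_pow_eq_zero hc ?_ _
      simp [Ne.symm hic, hac, hbc]
    · rfl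

end TestTensors

end Tensors

section Independence

variable {n e : ℕ}

theorem eq_zero_of_dotProduct_contractPow_eq_zero (he : 2 ≤ e) {u w : Fin n → ℝ} {a b : Fin n}
    (hab : a ≠ b) (ha : u a ≠ 0) (hb : u b ≠ 0)
    (h : ∀ S ∈ VpmiSubmodule (e + 1) n, w ⬝ᵥ contractPow u S = 0) : w = 0 := by
  obtain ⟨k, rfl⟩ := Nat.exists_eq_add_of_le' (one_le_two.trans he)
  ext c
  by_cases hc : u c = 0
  · have hac : a ≠ c := by rintro rfl; exact ha hc
    have hbc : b ≠ c := by rintro rfl; exact hb hc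
    have hmul := h _ (monomialTensor_triple_mem hab hac hbc (k := k) (by omega))
    rw [contractPow_monomialTensor_mul u k hab hac hbc hc, dotProduct_single] at hmul
    have hk : (k + 1 : ℝ) ≠ 0 := by positivity
    simpa [ha, hb, hk] using hmul
  · have hpow := h _ (monomialTensor_single_mem (k.add_one_ne_zero) c)
    rw [contractPow_monomialTensor_power, dotProduct_single] at hpow
    simpa [hc] using hpow

theorem dotProduct_eq_zero_of_mul_eq_dotProduct {u w : Fin n → ℝ} {a b : Fin n}
    (hab : a ≠ b) (ha : u a ≠ 0) (hb : u b ≠ 0) (h : ∀ c, u c ≠ 0 → w c * u c = w ⬝ᵥ u) :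
    w ⬝ᵥ u = 0 := by
  have hcount : w ⬝ᵥ u = (Finset.univ.filter fun c => u c ≠ 0).card * (w ⬝ᵥ u) := by
    rw [← nsmul_eq_mul, ← Finset.sum_const, Finset.sum_filter]
    refine Finset.sum_congr rfl fun c _ => ?_
    split_ifs with hc
    · exact h c hc
    · rw [not_not.mp hc, mul_zero]
  have hcard : (1 : ℝ) < (Finset.univ.filter fun c => u c ≠ 0).card :=
    mod_cast Finset.one_lt_card.mpr ⟨a, by simp [ha], b, by simp [hb], hab⟩
  exact (mul_eq_zero.mp (by linear_combination -hcount)).resolve_left (sub_pos.mpr hcard).ne'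

theorem eq_zero_of_dotProduct_contractPow_eq_diagonal {u w : Fin n → ℝ} {a b : Fin n}
    (hab : a ≠ b) (ha : u a ≠ 0) (hb : u b ≠ 0)
    (h : ∀ S ∈ VpmiSubmodule 3 n,
      w ⬝ᵥ contractPow u S = (w ⬝ᵥ u) * (u ⬝ᵥ fun j => S fun _ => j)) : w = 0 := by
  have hdiag (β : Fin n →₀ ℕ) (j : Fin n) :
      monomialTensor 3 β (fun _ => j) = if Finsupp.single j 3 = β then 1 else 0 := by
    rw [monomialTensor, indexCount_const]
  have hsupp (c : Fin n) (hc : u c ≠ 0) : w c * u c = w ⬝ᵥ u := by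
    have hpow := h _ (monomialTensor_single_mem two_ne_zero c)
    simp only [contractPow_monomialTensor_power, dotProduct_single, hdiag,
      Finsupp.single_left_inj three_ne_zero] at hpow
    refine mul_right_cancel₀ hc ?_
    simpa [dotProduct, sq, mul_assoc] using hpow
  have hnsupp (c : Fin n) (hc : u c = 0) : w c = 0 := by
    have hac : a ≠ c := by rintro rfl; exact ha hc
    have hbc : b ≠ c := by rintro rfl; exact hb hc
    have hne (j : Fin n) : Finsupp.single j 3 ≠
        Finsupp.single a 1 + Finsupp.single b 1 + Finsupp.single c 1 := fun h => by
      have h_at := DFunLike.congr_fun h a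
      simp only [Finsupp.add_apply, Finsupp.single_apply] at h_at
      grind
    have hmul := h _ (monomialTensor_triple_mem hab hac hbc one_ne_zero)
    rw [contractPow_monomialTensor_mul u 1 hab hac hbc hc, dotProduct_single] at hmul
    simpa [dotProduct, hdiag, hne, ha, hb, one_add_one_eq_two] using hmul
  have ht : w ⬝ᵥ u = 0 := dotProduct_eq_zero_of_mul_eq_dotProduct hab ha hb hsupp
  ext c
  by_cases hc : u c = 0
  · exact hnsupp c hc
  · exact (mul_eq_zero.mp ((hsupp c hc).trans ht)).resolve_right hc

theorem mul_pow_mul_le_two_mul_sub_pow (m : ℕ) {x y : ℝ} (hy : 0 ≤ y) (hxy : y ≤ x) :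
    (m + 2) * (x * y) ^ m * (x ^ 4 - y ^ 4) ≤ 2 * (x ^ (2 * (m + 2)) - y ^ (2 * (m + 2))) := by
  induction m using Nat.twoStepInduction with
  | zero => exact le_of_eq (by ring)
  | one =>
    have hgap : 0 ≤ (x ^ 2 - y ^ 2) * ((x - y) ^ 2 * (2 * x ^ 2 + x * y + 2 * y ^ 2)) := by
      have hsq : 0 ≤ x ^ 2 - y ^ 2 := sub_nonneg.mpr (pow_le_pow_left₀ hy hxy 2)
      have hx : 0 ≤ x := hy.trans hxy
      positivity
    push_cast
    linear_combination hgap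
  | more m ih _ =>
    have hgap (i : ℕ) : 0 ≤ x ^ i - y ^ i := sub_nonneg.mpr (pow_le_pow_left₀ hy hxy i)
    have hstep := mul_nonneg (hgap 2) (mul_nonneg (hgap (m + 4)) (hgap (m + 2)))
    push_cast
    linear_combination (x * y) ^ 2 * ih + 2 * hstep

theorem mul_pow_mul_lt_two_mul_sub_pow {m : ℕ} (hm : m ≠ 0) {x y : ℝ} (hy : 0 ≤ y)
    (hxy : y < x) :
    (m + 2) * (x * y) ^ m * (x ^ 4 - y ^ 4) < 2 * (x ^ (2 * (m + 2)) - y ^ (2 * (m + 2))) := by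
  have hx : 0 < x := hy.trans_lt hxy
  have hgap {i : ℕ} (hi : i ≠ 0) : 0 < x ^ i - y ^ i := sub_pos.mpr (pow_lt_pow_left₀ hxy hy hi)
  match m, hm with
  | 1, _ =>
    have hstep : 0 < (x ^ 2 - y ^ 2) * ((x - y) ^ 2 * (2 * x ^ 2 + x * y + 2 * y ^ 2)) := by
      have hsq := hgap two_ne_zero
      have := sub_pos.mpr hxy
      positivity
    push_cast
    linear_combination hstep
  | m + 2, _ =>
    have hstep := mul_pos (hgap two_ne_zero)
      (mul_pos (hgap (i := m + 4) (by omega)) (hgap (i := m + 2) (by omega)))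
    push_cast
    linear_combination
      (x * y) ^ 2 * mul_pow_mul_le_two_mul_sub_pow m hy hxy.le + 2 * hstep

theorem sq_mul_pow_mul_lt_sub_pow_sq {m : ℕ} (hm : m ≠ 0) {a b : ℝ} (hab : a ^ 2 ≠ b ^ 2) :
    ((m + 2) / 2) ^ 2 * (a * b) ^ m * (a ^ 2 - b ^ 2) ^ 2 < (a ^ (m + 2) - b ^ (m + 2)) ^ 2 := by
  wlog hlt : |b| < |a| generalizing a b with H
  · have hne : |a| ≠ |b| := fun h => hab (sq_eq_sq_iff_abs_eq_abs a b |>.mpr h)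
    convert H hab.symm (lt_of_le_of_ne (not_lt.mp hlt) hne) using 1 <;> ring
  have hsqrt (x : ℝ) : √|x| ^ 2 = |x| := Real.sq_sqrt (abs_nonneg x)
  have hquart (x : ℝ) : √|x| ^ 4 = x ^ 2 := by
    rw [show 4 = 2 * 2 from rfl, pow_mul, hsqrt, sq_abs]
  have hmean : (m + 2) * (√|a| * √|b|) ^ m * (a ^ 2 - b ^ 2)
      < 2 * (|a| ^ (m + 2) - |b| ^ (m + 2)) := by
    simpa only [pow_mul, hsqrt, hquart] using mul_pow_mul_lt_two_mul_sub_pow hm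
      (Real.sqrt_nonneg |b|) (Real.sqrt_lt_sqrt (abs_nonneg b) hlt)
  have hΔ : 0 ≤ a ^ 2 - b ^ 2 := sub_nonneg.mpr (sq_le_sq.mpr hlt.le)
  calc ((m + 2) / 2) ^ 2 * (a * b) ^ m * (a ^ 2 - b ^ 2) ^ 2
      ≤ ((m + 2) / 2) ^ 2 * |a * b| ^ m * (a ^ 2 - b ^ 2) ^ 2 := by
        refine mul_le_mul_of_nonneg_right (mul_le_mul_of_nonneg_left ?_ (by positivity))
          (by positivity)
        exact (le_abs_self ((a * b) ^ m)).trans_eq (abs_pow _ m)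
    _ = ((m + 2) * (√|a| * √|b|) ^ m * (a ^ 2 - b ^ 2) / 2) ^ 2 := by
        rw [abs_mul, ← hsqrt a, ← hsqrt b, ← mul_pow, pow_right_comm, hsqrt, hsqrt]; ring
    _ < (2 * (|a| ^ (m + 2) - |b| ^ (m + 2)) / 2) ^ 2 := by gcongr
    _ = (|a ^ (m + 2)| - |b ^ (m + 2)|) ^ 2 := by
        rw [mul_div_cancel_left₀ _ two_ne_zero, abs_pow, abs_pow]
    _ ≤ (a ^ (m + 2) - b ^ (m + 2)) ^ 2 := sq_le_sq.mpr (abs_abs_sub_abs_le _ _)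

theorem eq_of_two_by_two_system (m : ℕ) {a b x y : ℝ} (ha : a ≠ 0) (hb : b ≠ 0)
    (hab : a ^ 2 ≠ b ^ 2)
    (h1 : (m + 2) / 2 * x * a ^ m * (a ^ 2 - b ^ 2) = y * (a ^ (m + 2) - b ^ (m + 2)))
    (h2 : (m + 2) / 2 * y * b ^ m * (a ^ 2 - b ^ 2) = x * (a ^ (m + 2) - b ^ (m + 2))) :
    x = y := by
  have hΔ : a ^ 2 - b ^ 2 ≠ 0 := sub_ne_zero.mpr hab
  rcases eq_or_ne m 0 with rfl | hm
  · exact mul_right_cancel₀ hΔ (by linear_combination h1)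
  have hdet : x * y * ((a ^ (m + 2) - b ^ (m + 2)) ^ 2
      - ((m + 2) / 2) ^ 2 * (a * b) ^ m * (a ^ 2 - b ^ 2) ^ 2) = 0 := by
    rw [mul_pow]
    linear_combination -((m + 2) / 2 * x * a ^ m * (a ^ 2 - b ^ 2)) * h2
      - x * (a ^ (m + 2) - b ^ (m + 2)) * h1
  have hm2 : (m + 2 : ℝ) ≠ 0 := by positivity
  rcases mul_eq_zero.mp ((mul_eq_zero.mp hdet).resolve_right
    (sub_pos.mpr (sq_mul_pow_mul_lt_sub_pow_sq hm hab)).ne') with rfl | rfl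
  · exact .symm (by simpa [hm2, hb, hΔ] using h2.symm)
  · simpa [hm2, ha, hΔ] using h1

/-- The condition under which the eigenvectors of generic tensors in `Vpmi` are independent: no
coordinate of `u` vanishes, and the squares of its coordinates cannot be divided into two groups
with equal sums. -/
structure InGeneralPosition (u : Fin n → ℝ) : Prop where
  ne_zero : ∀ j, u j ≠ 0
  sum_sq_ne : ∀ s : Finset (Fin n), ∑ j ∈ s, u j ^ 2 ≠ ∑ j ∈ sᶜ, u j ^ 2

theorem InGeneralPosition.nonempty {u : Fin n → ℝ} (h : InGeneralPosition u) :
    Nonempty (Fin n) := by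
  by_contra! hempty
  exact h.sum_sq_ne ∅ (by simp)

theorem InGeneralPosition.smul {u : Fin n → ℝ} (h : InGeneralPosition u) {c : ℝ} (hc : c ≠ 0) :
    InGeneralPosition (c • u) where
  ne_zero j := mul_ne_zero hc (h.ne_zero j)
  sum_sq_ne s hs := h.sum_sq_ne s (mul_left_cancel₀ (pow_ne_zero 2 hc) (by
    simpa only [Pi.smul_apply, smul_eq_mul, mul_pow, ← Finset.mul_sum] using hs))

theorem InGeneralPosition.exists_sq_ne_sq {u r : Fin n → ℝ} (hu : InGeneralPosition u)
    (hr : ∀ j, r j ≠ 0) (hru : ∑ j, r j * u j ^ 2 = 0) : ∃ a b, r a ^ 2 ≠ r b ^ 2 := by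
  classical
  by_contra! hsq
  obtain ⟨i⟩ := hu.nonempty
  refine hu.sum_sq_ne {j | r j = r i} (mul_left_cancel₀ (hr i) (sub_eq_zero.mp ?_))
  rw [← hru, ← Finset.sum_add_sum_compl {j | r j = r i} fun j => r j * u j ^ 2, sub_eq_add_neg,
    Finset.mul_sum, Finset.mul_sum, ← Finset.sum_neg_distrib]
  congr 1 <;> refine Finset.sum_congr rfl fun j hj => ?_
  · simp_all
  · have hneg : r j = -r i :=
      (sq_eq_sq_iff_eq_or_eq_neg.mp (hsq j i)).resolve_left (by simpa using hj)
    rw [hneg, neg_mul]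

theorem InGeneralPosition.eq_zero_of_pairwise_system {u r y : Fin n → ℝ}
    (hu : InGeneralPosition u) (hr : ∀ j, r j ≠ 0) (hru : ∑ j, r j * u j ^ 2 = 0)
    (hyu : ∑ j, y j * u j ^ 2 = 0) (m : ℕ)
    (hsys : ∀ a b, a ≠ b → (m + 2) / 2 * y a * r a ^ m * (r a ^ 2 - r b ^ 2)
      = y b * (r a ^ (m + 2) - r b ^ (m + 2))) : y = 0 := by
  have heq {a b : Fin n} (hab : r a ^ 2 ≠ r b ^ 2) : y a = y b := by
    have hne : a ≠ b := by rintro rfl; exact hab rfl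
    exact eq_of_two_by_two_system m (hr a) (hr b) hab (hsys a b hne)
      (by linear_combination -(hsys b a hne.symm))
  obtain ⟨a, b, hab⟩ := hu.exists_sq_ne_sq hr hru
  have hconst (j : Fin n) : y j = y a := by
    by_cases hj : r j ^ 2 = r a ^ 2
    · rw [heq hab, heq (hj ▸ hab)]
    · exact heq hj
  simp only [hconst, ← Finset.mul_sum] at hyu
  have hsq : ∑ j, u j ^ 2 ≠ 0 := by simpa using hu.sum_sq_ne Finset.univ
  exact funext fun j => (hconst j).trans ((mul_eq_zero.mp hyu).resolve_right hsq)

theorem add_mul_pow_eq_zero_of_dotProduct_contractPow_add_eq_zero (he : e ≠ 0)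
    {u r w w' : Fin n → ℝ} (hu : ∀ j, u j ≠ 0)
    (h : ∀ S ∈ VpmiSubmodule (e + 1) n,
      w ⬝ᵥ contractPow u S + w' ⬝ᵥ contractPow (r * u) S = 0) (j : Fin n) :
    w j + w' j * r j ^ e = 0 := by
  have h0 := h _ (monomialTensor_single_mem he j)
  simp only [contractPow_monomialTensor_power, dotProduct_single, Pi.mul_apply] at h0
  exact (mul_eq_zero.mp (by linear_combination h0)).resolve_right (pow_ne_zero e (hu j))

theorem pairwise_system_of_dotProduct_contractPow_add_eq_zero {m : ℕ} {u r y w w' : Fin n → ℝ}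
    (hu : ∀ j, u j ≠ 0) (hw'y : ∀ j, r j * w' j = y j * u j)
    (h : ∀ S ∈ VpmiSubmodule (m + 4) n,
      w ⬝ᵥ contractPow u S + w' ⬝ᵥ contractPow (r * u) S = 0) {a b : Fin n} (hab : a ≠ b) :
    (m + 2) / 2 * y a * r a ^ m * (r a ^ 2 - r b ^ 2)
      = y b * (r a ^ (m + 2) - r b ^ (m + 2)) := by
  have hdiag (j : Fin n) : w j + w' j * r j ^ (m + 3) = 0 :=
    add_mul_pow_eq_zero_of_dotProduct_contractPow_add_eq_zero (by omega) hu h j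
  have hmem : monomialTensor (m + 4) (Finsupp.single a (m + 2) + Finsupp.single b 2) ∈
      VpmiSubmodule (m + 4) n := monomialTensor_mem fun j => by
    simp only [Finsupp.add_apply, Finsupp.single_apply]
    grind
  have h0 := h _ hmem
  simp only [contractPow_monomialTensor_sq u (m + 1) hab,
    contractPow_monomialTensor_sq (r * u) (m + 1) hab, dotProduct_add, dotProduct_single,
    Pi.mul_apply, Nat.cast_choose_two] at h0
  push_cast at h0
  refine mul_left_cancel₀ (a := (m + 3) * u a ^ (m + 2) * u b ^ 2) (by
    have := hu a
    have := hu b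
    positivity) ?_
  linear_combination -h0
    + (m + 3) * (m + 2) / 2 * u a ^ (m + 1) * u b ^ 2 *
      (hdiag a + r a ^ m * (r b ^ 2 - r a ^ 2) * hw'y a)
    + (m + 3) * u a ^ (m + 2) * u b * (hdiag b + (r a ^ (m + 2) - r b ^ (m + 2)) * hw'y b)

theorem InGeneralPosition.eq_zero_of_dotProduct_contractPow_add_eq_zero (he : 3 ≤ e)
    {u v w w' : Fin n → ℝ} (hu : InGeneralPosition u) (hv : ∀ j, v j ≠ 0) (huv : u ⬝ᵥ v = 0)
    (hw' : v ⬝ᵥ w' = 0)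
    (h : ∀ S ∈ VpmiSubmodule (e + 1) n, w ⬝ᵥ contractPow u S + w' ⬝ᵥ contractPow v S = 0) :
    w = 0 ∧ w' = 0 := by
  obtain ⟨m, rfl⟩ := Nat.exists_eq_add_of_le' he
  obtain ⟨r, rfl⟩ : ∃ r : Fin n → ℝ, v = r * u :=
    ⟨fun j => v j / u j, funext fun j => (div_mul_cancel₀ (v j) (hu.ne_zero j)).symm⟩
  obtain ⟨y, hw'y⟩ : ∃ y : Fin n → ℝ, ∀ j, r j * w' j = y j * u j :=
    ⟨fun j => r j * w' j / u j, fun j => (div_mul_cancel₀ _ (hu.ne_zero j)).symm⟩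
  have hr (j : Fin n) : r j ≠ 0 := left_ne_zero_of_mul (hv j)
  have hru : ∑ j, r j * u j ^ 2 = 0 :=
    (Finset.sum_congr rfl fun j _ => by rw [Pi.mul_apply]; ring).trans huv
  have hyu : ∑ j, y j * u j ^ 2 = 0 :=
    (Finset.sum_congr rfl fun j _ => by
      rw [Pi.mul_apply]; linear_combination -u j * hw'y j).trans hw'
  have hy : y = 0 := hu.eq_zero_of_pairwise_system hr hru hyu m fun _ _ hab =>
    pairwise_system_of_dotProduct_contractPow_add_eq_zero hu.ne_zero hw'y h hab
  have hw'0 : w' = 0 := funext fun j =>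
    (mul_eq_zero.mp ((hw'y j).trans (by simp [hy]))).resolve_left (hr j)
  refine ⟨funext fun j => ?_, hw'0⟩
  simpa [hw'0] using
    add_mul_pow_eq_zero_of_dotProduct_contractPow_add_eq_zero (by omega) hu.ne_zero h j

end Independence

section Eigenvectors

open MvPolynomial

variable {n e : ℕ}

/-- `u` is an eigenvector of `T`, or zero. -/
def IsTensorEigenvector (T : (Fin (e + 1) → Fin n) → ℝ) (u : Fin n → ℝ) : Prop :=
  ∃ c : ℝ, contractPow u T = c • u

theorem IsTensorEigenvector.smul {T : (Fin (e + 1) → Fin n) → ℝ} {u : Fin n → ℝ}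
    (h : IsTensorEigenvector T u) {s : ℝ} (hs : s ≠ 0) : IsTensorEigenvector T (s • u) := by
  obtain ⟨c, hc⟩ := h
  exact ⟨s ^ e * c * s⁻¹, by rw [contractPow_smul, hc, smul_smul, smul_smul,
    inv_mul_cancel_right₀ hs]⟩

/-- The `2 × 2` minor with rows `a` and `k` of the matrix with columns `U` and `T U^e`, which is
linear in `T`. The minors with a fixed `a` are the equations for eigenvectors with nonzero `a`-th
coordinate. -/
noncomputable def eigenEquation {S : Type*} [CommRing S] [Algebra ℝ S] (U : Fin n → S)
    (a k : Fin n) : ((Fin (e + 1) → Fin n) → ℝ) →ₗ[ℝ] S :=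
  LinearMap.mulLeft ℝ (U a) ∘ₗ LinearMap.proj k ∘ₗ contractPow U -
    LinearMap.mulLeft ℝ (U k) ∘ₗ LinearMap.proj a ∘ₗ contractPow U

theorem eigenEquation_apply {S : Type*} [CommRing S] [Algebra ℝ S] (U : Fin n → S)
    (a k : Fin n) (T : (Fin (e + 1) → Fin n) → ℝ) :
    eigenEquation U a k T = U a * contractPow U T k - U k * contractPow U T a := rfl

theorem eval_eigenEquation {ι : Type*} (p : ι → ℝ) (U : Fin n → MvPolynomial ι ℝ) (a k : Fin n)
    (T : (Fin (e + 1) → Fin n) → ℝ) :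
    eval p (eigenEquation U a k T) = eigenEquation (fun i => eval p (U i)) a k T := by
  simp only [eigenEquation_apply, map_sub, map_mul, eval_contractPow]

theorem IsTensorEigenvector.eigenEquation_eq_zero {T : (Fin (e + 1) → Fin n) → ℝ}
    {u : Fin n → ℝ} (h : IsTensorEigenvector T u) (a k : Fin n) : eigenEquation u a k T = 0 := by
  obtain ⟨c, hc⟩ := h
  rw [eigenEquation_apply, hc, Pi.smul_apply, Pi.smul_apply, smul_eq_mul, smul_eq_mul]
  ring

theorem exists_dotProduct_contractPow_eq_sum_eigenEquation (e : ℕ) {u : Fin n → ℝ} {a : Fin n}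
    (ha : u a ≠ 0) (c : {k // k ≠ a} → ℝ) :
    ∃ w : Fin n → ℝ, u ⬝ᵥ w = 0 ∧ (w = 0 → c = 0) ∧ ∀ S : (Fin (e + 1) → Fin n) → ℝ,
      w ⬝ᵥ contractPow u S = ∑ k, c k * eigenEquation u a k S := by
  set c' : Fin n → ℝ := Function.extend Subtype.val c 0 with hc'
  have hc'a : c' a = 0 := Function.extend_apply' _ _ _ (by simp)
  have hc'k (k : {k // k ≠ a}) : c' k = c k := Subtype.val_injective.extend_apply _ _ _
  have hdot (x : Fin n → ℝ) : c' ⬝ᵥ x = ∑ k, c k * x k := by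
    refine .symm (Fintype.sum_of_injective Subtype.val Subtype.val_injective _ _
      (fun k hk => ?_) fun k => by rw [hc'k])
    obtain rfl : k = a := by simpa using hk
    rw [hc'a, zero_mul]
  refine ⟨u a • c' - (c' ⬝ᵥ u) • Pi.single a 1, ?_, fun hw => funext fun k => ?_, fun S => ?_⟩
  · rw [dotProduct_sub, dotProduct_smul, dotProduct_smul, dotProduct_single_one, dotProduct_comm]
    simp only [smul_eq_mul]
    ring
  · simpa [k.2, ha, hc'k] using congr_fun hw k
  · rw [sub_dotProduct, smul_dotProduct, smul_dotProduct, single_one_dotProduct, hdot, hdot,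
      smul_eq_mul, smul_eq_mul, Finset.mul_sum, Finset.sum_mul, ← Finset.sum_sub_distrib]
    refine Finset.sum_congr rfl fun k _ => ?_
    rw [eigenEquation_apply]
    ring

/-- The coordinate functions on the affine chart `u_a = 1`. -/
noncomputable def affineChart (a j : Fin n) : MvPolynomial {k // k ≠ a} ℝ :=
  if h : j = a then 1 else X ⟨j, h⟩

theorem eval_affineChart {u : Fin n → ℝ} {a : Fin n} (ha : u a = 1) (j : Fin n) :
    eval (fun k : {k // k ≠ a} => u k) (affineChart a j) = u j := by
  rw [affineChart]
  split_ifs with h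
  · rw [map_one, h, ha]
  · rw [eval_X]

theorem eventually_eigenvector_avoids (he : 2 ≤ e) (a : Fin n) {R : MvPolynomial (Fin n) ℝ}
    {x : Fin n → ℝ} (hx : x a = 1) (hR : eval x R ≠ 0) :
    ∀ᶠ T in zariskiGeneric (VpmiSubmodule (e + 1) n), ∀ u : Fin n → ℝ,
      IsTensorEigenvector T u → u a = 1 → (∃ b, a ≠ b ∧ u b ≠ 0) → eval u R ≠ 0 := by
  have eval_chart {u : Fin n → ℝ} (hu : u a = 1) :
      eval (fun k : {k // k ≠ a} => u k) (bind₁ (affineChart a) R) = eval u R := by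
    simp only [eval, eval₂Hom_bind₁]
    exact congr_arg (fun v => eval v R) (funext (eval_affineChart hu))
  have hR' : bind₁ (affineChart a) R ≠ 0 := fun h0 => hR (by rw [← eval_chart hx, h0, map_zero])
  filter_upwards [eventually_exists_linear_relation (VpmiSubmodule (e + 1) n) le_rfl
    (fun k : {k // k ≠ a} => eigenEquation (affineChart a) a k) hR']
    with T hT u hu ha ⟨b, hab, hb⟩ hRu
  have eval_eq (k : {k // k ≠ a}) (S : (Fin (e + 1) → Fin n) → ℝ) :
      eval (fun k : {k // k ≠ a} => u k) (eigenEquation (affineChart a) a k S)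
        = eigenEquation u a k S := by
    rw [eval_eigenEquation]
    simp only [eval_affineChart ha]
  obtain ⟨c, hc, hrel⟩ := hT _ ((eval_chart ha).trans hRu)
    fun k => (eval_eq k T).trans (hu.eigenEquation_eq_zero a k)
  have ha0 : u a ≠ 0 := ha ▸ one_ne_zero
  obtain ⟨w, -, hw, hwS⟩ := exists_dotProduct_contractPow_eq_sum_eigenEquation e ha0 c
  refine hc (hw (eq_zero_of_dotProduct_contractPow_eq_zero he hab ha0 hb fun S hS => ?_))
  simpa only [hwS, eval_eq] using hrel S hS

theorem eventually_eigenvector_inGeneralPosition (he : 2 ≤ e) :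
    ∀ᶠ T in zariskiGeneric (VpmiSubmodule (e + 1) n), ∀ (u : Fin n → ℝ) (a b : Fin n),
      IsTensorEigenvector T u → a ≠ b → u a ≠ 0 → u b ≠ 0 → InGeneralPosition u := by
  have hcoord (a j : Fin n) := eventually_eigenvector_avoids he a (x := 1) (R := X j) rfl (by simp)
  have hsplit (a : Fin n) (s : Finset (Fin n)) := eventually_eigenvector_avoids he a
    (x := Pi.single a 1) (R := ∑ j ∈ s, X j ^ 2 - ∑ j ∈ sᶜ, X j ^ 2) (Pi.single_eq_same a 1) (by
      by_cases ha : a ∈ s <;> simp [Pi.single_apply, ha])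
  filter_upwards [Filter.eventually_all.mpr fun a => Filter.eventually_all.mpr (hcoord a),
    Filter.eventually_all.mpr fun a => Filter.eventually_all.mpr (hsplit a)]
    with T hcoord hsplit u a b hu hab ha hb
  have hu' : IsTensorEigenvector T ((u a)⁻¹ • u) := hu.smul (inv_ne_zero ha)
  have ha' : ((u a)⁻¹ • u) a = 1 := inv_mul_cancel₀ ha
  have hb' : ∃ b, a ≠ b ∧ ((u a)⁻¹ • u) b ≠ 0 := ⟨b, hab, mul_ne_zero (inv_ne_zero ha) hb⟩
  have hgen : InGeneralPosition ((u a)⁻¹ • u) := by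
    refine ⟨fun j => ?_, fun s => ?_⟩
    · simpa only [eval_X] using hcoord a j _ hu' ha' hb'
    · simpa only [map_sub, map_sum, map_pow, eval_X, sub_ne_zero] using hsplit a s _ hu' ha' hb'
  simpa only [smul_inv_smul₀ ha] using hgen.smul ha

theorem eventually_eigenvectors_not_orthogonal_of_apply_eq_one (he : 3 ≤ e) (a : Fin n) :
    ∀ᶠ T in zariskiGeneric (VpmiSubmodule (e + 1) n), ∀ u v : Fin n → ℝ,
      IsTensorEigenvector T u → IsTensorEigenvector T v → InGeneralPosition u →
        InGeneralPosition v → u a = 1 → v a = 1 → u ⬝ᵥ v ≠ 0 := by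
  let ι := {k : Fin n // k ≠ a}
  let U (j : Fin n) : MvPolynomial (ι ⊕ ι) ℝ := rename Sum.inl (affineChart a j)
  let V (j : Fin n) : MvPolynomial (ι ⊕ ι) ℝ := rename Sum.inr (affineChart a j)
  let pt (u v : Fin n → ℝ) : ι ⊕ ι → ℝ := Sum.elim (fun k => u k) (fun k => v k)
  have eval_U {u : Fin n → ℝ} (v : Fin n → ℝ) (hu : u a = 1) (j : Fin n) :
      eval (pt u v) (U j) = u j := by
    rw [eval_rename]; exact eval_affineChart hu j
  have eval_V (u : Fin n → ℝ) {v : Fin n → ℝ} (hv : v a = 1) (j : Fin n) :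
      eval (pt u v) (V j) = v j := by
    rw [eval_rename]; exact eval_affineChart hv j
  have eval_R {u v : Fin n → ℝ} (hu : u a = 1) (hv : v a = 1) :
      eval (pt u v) (∑ j, U j * V j) = u ⬝ᵥ v := by
    simp only [map_sum, map_mul, eval_U v hu, eval_V u hv, dotProduct]
  have hR : ∑ j, U j * V j ≠ 0 := fun h0 => by
    have h1 : (Pi.single a 1 : Fin n → ℝ) a = 1 := Pi.single_eq_same a 1
    have := eval_R h1 h1
    simp [h0] at this
  filter_upwards [eventually_exists_linear_relation (VpmiSubmodule (e + 1) n) le_rfl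
    (Sum.elim (fun k : ι => eigenEquation U a k) fun k : ι => eigenEquation V a k) hR]
    with T hT u v hu hv hu' hv' hua hva huv
  obtain ⟨c, hc, hrel⟩ := hT (pt u v) ((eval_R hua hva).trans huv) (by
    rintro (k | k)
    · simp only [Sum.elim_inl, eval_eigenEquation, eval_U v hua, hu.eigenEquation_eq_zero]
    · simp only [Sum.elim_inr, eval_eigenEquation, eval_V u hva, hv.eigenEquation_eq_zero])
  obtain ⟨w, -, hwc, hw⟩ :=
    exists_dotProduct_contractPow_eq_sum_eigenEquation e (hu'.ne_zero a) (c ∘ Sum.inl)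
  obtain ⟨w', hvw', hwc', hw'⟩ :=
    exists_dotProduct_contractPow_eq_sum_eigenEquation e (hv'.ne_zero a) (c ∘ Sum.inr)
  obtain ⟨hw0, hw'0⟩ := hu'.eq_zero_of_dotProduct_contractPow_add_eq_zero he hv'.ne_zero huv hvw'
    (w := w) fun S hS => by
      simpa only [hw, hw', Function.comp_apply, Fintype.sum_sum_type, Sum.elim_inl, Sum.elim_inr,
        eval_eigenEquation, eval_U v hua, eval_V u hva] using hrel S hS
  refine hc (funext fun k => ?_)
  rcases k with k | k
  · exact congr_fun (hwc hw0) k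
  · exact congr_fun (hwc' hw'0) k

theorem eventually_eigenvectors_not_orthogonal (he : 3 ≤ e) :
    ∀ᶠ T in zariskiGeneric (VpmiSubmodule (e + 1) n), ∀ u v : Fin n → ℝ,
      IsTensorEigenvector T u → IsTensorEigenvector T v → InGeneralPosition u →
        InGeneralPosition v → u ⬝ᵥ v ≠ 0 := by
  filter_upwards [Filter.eventually_all.mpr fun a =>
    eventually_eigenvectors_not_orthogonal_of_apply_eq_one he a] with T hT u v hu hv hu' hv' huv
  obtain ⟨a⟩ := hu'.nonempty
  have hua := inv_ne_zero (hu'.ne_zero a)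
  have hva := inv_ne_zero (hv'.ne_zero a)
  refine hT a ((u a)⁻¹ • u) ((v a)⁻¹ • v) (hu.smul hua) (hv.smul hva) (hu'.smul hua)
    (hv'.smul hva) (inv_mul_cancel₀ (hu'.ne_zero a)) (inv_mul_cancel₀ (hv'.ne_zero a)) ?_
  rw [smul_dotProduct, dotProduct_smul, huv, smul_zero, smul_zero]

theorem eventually_contractPow_ne_diagonal_smul :
    ∀ᶠ T in zariskiGeneric (VpmiSubmodule 3 n), ∀ (u : Fin n → ℝ) (a b : Fin n),
      a ≠ b → u a ≠ 0 → u b ≠ 0 →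
        contractPow u T ≠ (u ⬝ᵥ fun j => T fun _ => j) • u := by
  let diag : ((Fin 3 → Fin n) → ℝ) →ₗ[ℝ] MvPolynomial (Fin n) ℝ :=
    ∑ j, (LinearMap.toSpanSingleton ℝ _ (X j)) ∘ₗ LinearMap.proj fun _ => j
  let Φ (j : Fin n) : ((Fin 3 → Fin n) → ℝ) →ₗ[ℝ] MvPolynomial (Fin n) ℝ :=
    LinearMap.proj j ∘ₗ contractPow X - LinearMap.mulLeft ℝ (X j) ∘ₗ diag
  have eval_Φ (u : Fin n → ℝ) (j : Fin n) (S : (Fin 3 → Fin n) → ℝ) :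
      eval u (Φ j S) = contractPow u S j - u j * (u ⬝ᵥ fun j => S fun _ => j) := by
    simp [Φ, diag, eval_contractPow, dotProduct, mul_comm (S _), Finset.mul_sum, mul_assoc]
  have hR (a : Fin n) : (X a - 1 : MvPolynomial (Fin n) ℝ) ≠ 0 := fun h0 => by
    simpa using congr_arg (eval 0) h0
  filter_upwards [Filter.eventually_all.mpr fun a =>
    eventually_exists_linear_relation (VpmiSubmodule 3 n) le_rfl Φ (hR a)]
    with T hT u a b hab ha hb hTu
  set v := (u a)⁻¹ • u with hv
  have hva : v a = 1 := inv_mul_cancel₀ ha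
  have hTv : contractPow v T = (v ⬝ᵥ fun j => T fun _ => j) • v := by
    rw [hv, contractPow_smul, hTu, smul_dotProduct, smul_smul, smul_smul]
    congr 1
    simp only [smul_eq_mul]
    ring
  obtain ⟨c, hc, hrel⟩ := hT a v (by simp [hva]) fun j => by
    rw [eval_Φ, hTv, Pi.smul_apply, smul_eq_mul, mul_comm, sub_self]
  refine hc (eq_zero_of_dotProduct_contractPow_eq_diagonal hab (hva ▸ one_ne_zero)
    (mul_ne_zero (inv_ne_zero ha) hb) fun S hS => ?_)
  have := hrel S hS
  simp only [eval_Φ, mul_sub, Finset.sum_sub_distrib, ← mul_assoc, ← Finset.sum_mul] at this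
  exact sub_eq_zero.mp this

theorem sum_contractPow_orthogonal {T : (Fin 3 → Fin n) → ℝ} (hT : T ∈ VpmiSubmodule 3 n)
    {Q : Matrix (Fin n) (Fin n) ℝ} (hQ : Q.transpose * Q = 1) :
    ∑ k, contractPow (Q k) T = fun j => T fun _ => j := by
  have hcol (a b : Fin n) : ∑ k, Q k a * Q k b = if a = b then 1 else 0 := by
    rw [← Matrix.one_apply, ← hQ]; rfl
  ext j
  calc (∑ k, contractPow (Q k) T) j
      = ∑ idx : Fin 2 → Fin n, T (Fin.cons j idx) * if idx 0 = idx 1 then 1 else 0 := by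
        simp only [Finset.sum_apply, contractPow_apply, smul_eq_mul, Fin.prod_univ_two]
        rw [Finset.sum_comm]
        simp only [← Finset.mul_sum, hcol]
    _ = T (Fin.cons j fun _ => j) := by
        refine (Finset.sum_eq_single (fun _ => j) (fun idx _ hidx => ?_) (by simp)).trans (by simp)
        split_ifs with h
        · obtain ⟨i, rfl⟩ : ∃ i, idx = fun _ => i :=
            ⟨idx 0, by ext k; fin_cases k <;> simp [h]⟩
          rw [VpmiSubmodule.apply_cons_const hT, zero_mul]
          exact fun hj => hidx (by simp [hj])
        · exact mul_zero _
    _ = T fun _ => j := congr_arg T (by ext k; cases k using Fin.cases <;> rfl)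

/-- Every orthonormal basis consisting of eigenvectors of `T` is, up to signs and order, the
standard basis. -/
def HasOnlyStandardEigenbases (T : (Fin (e + 1) → Fin n) → ℝ) : Prop :=
  ∀ Q : Matrix (Fin n) (Fin n) ℝ, Q * Q.transpose = 1 → (∀ j, IsTensorEigenvector T (Q j)) →
    ∀ j a b, Q j a ≠ 0 → Q j b ≠ 0 → a = b

theorem eventually_hasOnlyStandardEigenbases_cubic :
    ∀ᶠ T in zariskiGeneric (VpmiSubmodule 3 n), HasOnlyStandardEigenbases T := by
  filter_upwards [eventually_contractPow_ne_diagonal_smul, eventually_zariskiGeneric_mem _]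
    with T hT hmem Q hQ heig j a b ha hb
  by_contra hab
  choose c hc using heig
  have hrow (k : Fin n) : Q j ⬝ᵥ Q k = if j = k then 1 else 0 := by
    rw [← Matrix.one_apply, ← hQ]; rfl
  have hcj : (Q j ⬝ᵥ fun i => T fun _ => i) = c j := by
    rw [← sum_contractPow_orthogonal hmem (mul_eq_one_comm.mp hQ), dotProduct_sum]
    simp [hc, hrow]
  exact hT (Q j) a b hab ha hb (by rw [hcj, hc])

theorem eventually_hasOnlyStandardEigenbases_of_three_le (he : 3 ≤ e) :
    ∀ᶠ T in zariskiGeneric (VpmiSubmodule (e + 1) n), HasOnlyStandardEigenbases T := by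
  filter_upwards [eventually_eigenvectors_not_orthogonal he,
    eventually_eigenvector_inGeneralPosition (by omega)]
    with T hT hgen Q hQ heig j a b ha hb
  by_contra hab
  have hrow (i k : Fin n) : Q i ⬝ᵥ Q k = if i = k then 1 else 0 := by
    rw [← Matrix.one_apply, ← hQ]; rfl
  have hj := hgen _ a b (heig j) hab ha hb
  have : Nontrivial (Fin n) := ⟨a, b, hab⟩
  obtain ⟨i, hij⟩ := exists_ne j
  have hji : Q j ⬝ᵥ Q i = 0 := (hrow j i).trans (if_neg hij.symm)
  obtain ⟨c, hc⟩ : ∃ c, Q i c ≠ 0 := Function.ne_iff.mp fun h0 => by simpa [h0] using hrow i i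
  have hsingle (d : Fin n) (hd : d ≠ c) : Q i d = 0 := by
    by_contra hd0
    exact hT _ _ (heig j) (heig i) hj (hgen _ d c (heig i) hd hd0 hc) hji
  rw [dotProduct, Finset.sum_eq_single c (fun d _ hd => by rw [hsingle d hd, mul_zero]) (by simp)]
    at hji
  exact mul_ne_zero (hj.ne_zero c) hc hji

theorem eventually_hasOnlyStandardEigenbases (he : 2 ≤ e) :
    ∀ᶠ T in zariskiGeneric (VpmiSubmodule (e + 1) n), HasOnlyStandardEigenbases T := by
  rcases he.eq_or_lt with rfl | h3
  · exact eventually_hasOnlyStandardEigenbases_cubic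
  · exact eventually_hasOnlyStandardEigenbases_of_three_le h3

theorem isTensorEigenvector_row_of_dotProduct_eq_zero {T : (Fin (e + 1) → Fin n) → ℝ}
    {Q : Matrix (Fin n) (Fin n) ℝ} (hQ : Q * Q.transpose = 1) {j : Fin n}
    (h : ∀ i, i ≠ j → Q i ⬝ᵥ contractPow (Q j) T = 0) : IsTensorEigenvector T (Q j) := by
  have hsingle : Q.mulVec (contractPow (Q j) T) = Pi.single j (Q j ⬝ᵥ contractPow (Q j) T) := by
    ext i
    by_cases hij : i = j
    · subst hij
      rw [Pi.single_eq_same]; rfl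
    · rw [Pi.single_eq_of_ne hij]
      exact h i hij
  refine ⟨Q j ⬝ᵥ contractPow (Q j) T, ?_⟩
  calc contractPow (Q j) T = Q.transpose.mulVec (Q.mulVec (contractPow (Q j) T)) := by
        rw [Matrix.mulVec_mulVec, mul_eq_one_comm.mp hQ, Matrix.one_mulVec]
    _ = (Q j ⬝ᵥ contractPow (Q j) T) • Q j := by
        ext i
        simp [hsingle, Matrix.mulVec_single, mul_comm]

end Eigenvectors

section Cumulants

variable {Ω ι : Type*} [MeasurableSpace Ω] [Fintype ι] [DecidableEq ι] {μ : Measure Ω}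
  {m n d : ℕ}

/-- The joint cumulant of a finite family of random variables, by the cumulant-moment relation. -/
noncomputable def jointCumulant (μ : Measure Ω) (Y : ι → Ω → ℝ) : ℝ :=
  ∑ π : Finpartition (Finset.univ : Finset ι),
    (-1 : ℝ) ^ (π.parts.card - 1) * (Nat.factorial (π.parts.card - 1) : ℝ) *
      ∏ B ∈ π.parts, ∫ ω, ∏ k ∈ B, Y k ω ∂μ

theorem cumulantTensor_apply (μ : Measure Ω) (z : Ω → Fin n → ℝ) (d : ℕ) (idx : Fin d → Fin n) :
    cumulantTensor μ z d idx = jointCumulant μ fun k ω => z ω (idx k) := rfl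

theorem jointCumulant_comp_perm (Y : ι → Ω → ℝ) (σ : Equiv.Perm ι) :
    jointCumulant μ (Y ∘ σ) = jointCumulant μ Y := by
  let iso : Finset ι ≃o Finset ι := ⟨σ.finsetCongr, Finset.map_subset_map⟩
  let permute (π : Finpartition (Finset.univ : Finset ι)) :
      Finpartition (Finset.univ : Finset ι) := (π.map iso).copy (Finset.map_univ_equiv σ)
  have permute_injective : Function.Injective permute := fun π π' h =>
    Finpartition.ext (Finset.map_injective _ (congr_arg Finpartition.parts h))
  refine Fintype.sum_bijective permute (Finite.injective_iff_bijective.mp permute_injective) _ _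
    fun π => ?_
  have hparts : (permute π).parts = π.parts.map iso.toEquiv.toEmbedding := rfl
  rw [hparts, Finset.card_map, Finset.prod_map]
  congr! 3 with B
  funext ω
  exact (Finset.prod_map B σ.toEmbedding fun k => Y k ω).symm

theorem jointCumulant_sub_of_moments_eq [Nonempty ι] {Ω' : Type*} [MeasurableSpace Ω']
    {μ' : Measure Ω'} {Y : ι → Ω → ℝ} {Y' : ι → Ω' → ℝ}
    (h : ∀ B ≠ Finset.univ, ∫ ω, ∏ k ∈ B, Y k ω ∂μ = ∫ ω, ∏ k ∈ B, Y' k ω ∂μ') :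
    jointCumulant μ Y - jointCumulant μ' Y' =
      (∫ ω, ∏ k, Y k ω ∂μ) - ∫ ω, ∏ k, Y' k ω ∂μ' := by
  have huniv : (Finset.univ : Finset ι) ≠ ⊥ := Finset.univ_nonempty.ne_empty
  rw [jointCumulant, jointCumulant, ← Finset.sum_sub_distrib,
    Finset.sum_eq_single (Finpartition.indiscrete huniv)]
  · simp
  · intro π _ hπ
    rw [sub_eq_zero]
    congr 1
    refine Finset.prod_congr rfl fun B hB => h B ?_
    rintro rfl
    refine hπ (Finpartition.ext (Finset.eq_singleton_iff_unique_mem.mpr ⟨hB, fun C hC => ?_⟩))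
    obtain ⟨k, hk⟩ := π.nonempty_of_mem_parts hC
    exact π.eq_of_mem_parts hC hB hk (Finset.mem_univ k)
  · simp

theorem jointCumulant_update (Y : ι → Ω → ℝ) (k : ι) (f : Ω → ℝ) :
    jointCumulant μ (Function.update Y k f) =
      ∑ π : Finpartition (Finset.univ : Finset ι),
        (-1 : ℝ) ^ (π.parts.card - 1) * (Nat.factorial (π.parts.card - 1) : ℝ) *
          ((∫ ω, f ω * ∏ l ∈ (π.part k).erase k, Y l ω ∂μ) *
            ∏ B ∈ π.parts.erase (π.part k), ∫ ω, ∏ l ∈ B, Y l ω ∂μ) := by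
  have update_apply (s : Finset ι) (hs : k ∉ s) (ω : Ω) :
      ∏ l ∈ s, Function.update Y k f l ω = ∏ l ∈ s, Y l ω :=
    Finset.prod_congr rfl fun l hl => by
      rw [Function.update_of_ne (ne_of_mem_of_not_mem hl hs)]
  refine Finset.sum_congr rfl fun π _ => ?_
  rw [← Finset.mul_prod_erase _ _ (π.part_mem.mpr (Finset.mem_univ k))]
  congr 2
  · congr! 2 with ω
    rw [← Finset.mul_prod_erase _ _ (π.mem_part (Finset.mem_univ k)), Function.update_self,
      update_apply _ (Finset.notMem_erase k _)]
  · refine Finset.prod_congr rfl fun B hB => ?_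
    obtain ⟨hBk, hB⟩ := Finset.mem_erase.mp hB
    simp only [update_apply B fun hk => hBk (π.part_eq_of_mem hB hk).symm]

theorem jointCumulant_update_smul (Y : ι → Ω → ℝ) (k : ι) (c : ℝ) (f : Ω → ℝ) :
    jointCumulant μ (Function.update Y k (c • f)) =
      c * jointCumulant μ (Function.update Y k f) := by
  simp only [jointCumulant_update, Finset.mul_sum]
  refine Finset.sum_congr rfl fun π _ => ?_
  simp only [Pi.smul_apply, smul_eq_mul, mul_assoc, integral_const_mul]
  ring

theorem integrable_prod_of_memLp [IsFiniteMeasure μ] {κ : Type*} {B : Finset κ}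
    (hB : B.card ≤ d) {Y : κ → Ω → ℝ} (hY : ∀ k ∈ B, MemLp (Y k) d μ) :
    Integrable (fun ω => ∏ k ∈ B, Y k ω) μ := by
  refine memLp_one_iff_integrable.mp ((MemLp.prod' hY).mono_exponent ?_)
  rw [Finset.sum_const, nsmul_eq_mul, ENNReal.one_le_inv, ← div_eq_mul_inv]
  exact ENNReal.div_le_of_le_mul (by rw [one_mul]; exact_mod_cast hB)

section Linearity

variable [IsFiniteMeasure μ] {Y : ι → Ω → ℝ} {f g : Ω → ℝ}

theorem integrable_mul_prod_erase_of_memLp (hY : ∀ k, MemLp (Y k) (Fintype.card ι) μ)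
    (hf : MemLp f (Fintype.card ι) μ) {s : Finset ι} {k : ι} (hk : k ∈ s) :
    Integrable (fun ω => f ω * ∏ l ∈ s.erase k, Y l ω) μ := by
  have hmem (l : ι) : MemLp (Function.update Y k f l) (Fintype.card ι) μ := by
    obtain rfl | hl := eq_or_ne l k
    · rwa [Function.update_self]
    · rw [Function.update_of_ne hl]; exact hY l
  refine (integrable_prod_of_memLp s.card_le_univ fun l _ => hmem l).congr (.of_forall fun ω => ?_)
  simp only [← Finset.mul_prod_erase _ _ hk, Function.update_self]
  congr 1
  exact Finset.prod_congr rfl fun l hl => by rw [Function.update_of_ne (Finset.ne_of_mem_erase hl)]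

theorem jointCumulant_update_add (hY : ∀ k, MemLp (Y k) (Fintype.card ι) μ)
    (hf : MemLp f (Fintype.card ι) μ) (hg : MemLp g (Fintype.card ι) μ) (k : ι) :
    jointCumulant μ (Function.update Y k (f + g)) =
      jointCumulant μ (Function.update Y k f) + jointCumulant μ (Function.update Y k g) := by
  simp only [jointCumulant_update, ← Finset.sum_add_distrib]
  refine Finset.sum_congr rfl fun π _ => ?_
  have hk := π.mem_part (Finset.mem_univ k)
  simp only [Pi.add_apply, add_mul]
  rw [integral_add (integrable_mul_prod_erase_of_memLp hY hf hk)
    (integrable_mul_prod_erase_of_memLp hY hg hk)]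
  ring

end Linearity

/-- The multilinear form `(u_1, …, u_d) ↦ κ(⟨u_1, z⟩, …, ⟨u_d, z⟩)` with coefficients `κ_d(z)`. -/
noncomputable def cumulantForm (μ : Measure Ω) [IsFiniteMeasure μ] (z : Ω → Fin n → ℝ)
    (hz : ∀ i, MemLp (fun ω => z ω i) (Fintype.card ι) μ) :
    MultilinearMap ℝ (fun _ : ι => Fin n → ℝ) ℝ :=
  have hdot (u : Fin n → ℝ) : MemLp (fun ω => u ⬝ᵥ z ω) (Fintype.card ι) μ :=
    memLp_finsetSum _ fun i _ => (hz i).const_mul (u i)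
  have hupdate (u : ι → Fin n → ℝ) (k : ι) (v : Fin n → ℝ) :
      (fun l ω => Function.update u k v l ⬝ᵥ z ω) =
        Function.update (fun l ω => u l ⬝ᵥ z ω) k fun ω => v ⬝ᵥ z ω := by
    funext l
    obtain rfl | hl := eq_or_ne l k <;> simp [*]
  MultilinearMap.mk' (fun u => jointCumulant μ fun k ω => u k ⬝ᵥ z ω)
    (fun u k v w => by
      simp only [hupdate, add_dotProduct]
      exact jointCumulant_update_add (fun k => hdot (u k)) (hdot v) (hdot w) k)
    (fun u k c v => by
      simp only [hupdate, smul_dotProduct]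
      exact jointCumulant_update_smul _ k c _)

theorem cumulantTensor_mulVec [IsFiniteMeasure μ] {z : Ω → Fin n → ℝ}
    (hz : ∀ i, MemLp (fun ω => z ω i) d μ) (Q : Matrix (Fin m) (Fin n) ℝ) (idx : Fin d → Fin m) :
    cumulantTensor μ (fun ω => Q.mulVec (z ω)) d idx =
      ∑ idx', (∏ k, Q (idx k) (idx' k)) * cumulantTensor μ z d idx' := by
  have hbasis (k : Fin d) : Q (idx k) = ∑ j, Q (idx k) j • Pi.single j 1 := by
    rw [← pi_eq_sum_univ']
  let κ := cumulantForm (ι := Fin d) μ z (by simpa using hz)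
  calc cumulantTensor μ (fun ω => Q.mulVec (z ω)) d idx
      = κ fun k => ∑ j, Q (idx k) j • Pi.single j 1 := by simp only [← hbasis]; rfl
    _ = ∑ idx' : Fin d → Fin n, (∏ k, Q (idx k) (idx' k)) * κ fun k => Pi.single (idx' k) 1 := by
        rw [κ.map_sum]
        exact Finset.sum_congr rfl fun idx' _ => κ.map_smul_univ _ _
    _ = ∑ idx', (∏ k, Q (idx k) (idx' k)) * cumulantTensor μ z d idx' := by
        congr! 2 with idx'
        change jointCumulant μ (fun k ω => (Pi.single (idx' k) 1 : Fin n → ℝ) ⬝ᵥ z ω) = _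
        simp only [single_one_dotProduct]
        rfl

theorem dotProduct_contractPow_cumulantTensor [IsFiniteMeasure μ] {z : Ω → Fin n → ℝ}
    (hz : ∀ i, MemLp (fun ω => z ω i) ((d + 1 : ℕ) : ENNReal) μ) (Q : Matrix (Fin m) (Fin n) ℝ)
    (i j : Fin m) :
    Q i ⬝ᵥ contractPow (Q j) (cumulantTensor μ z (d + 1)) =
      cumulantTensor μ (fun ω => Q.mulVec (z ω)) (d + 1) (Fin.cons i fun _ => j) := by
  rw [cumulantTensor_mulVec hz, ← (Fin.consEquiv fun _ => Fin n).sum_comp, Fintype.sum_prod_type]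
  refine Finset.sum_congr rfl fun a _ => ?_
  rw [contractPow_apply, Finset.mul_sum]
  refine Finset.sum_congr rfl fun idx _ => ?_
  simp only [Fin.consEquiv, Equiv.coe_fn_mk, Fin.prod_univ_succ, Fin.cons_zero, Fin.cons_succ,
    smul_eq_mul]
  ring

theorem cumulantTensor_eq_of_identDistrib {Ω' : Type*} [MeasurableSpace Ω'] {μ' : Measure Ω'}
    {z : Ω → Fin n → ℝ} {z' : Ω' → Fin n → ℝ} (h : IdentDistrib z z' μ μ') (d : ℕ) :
    cumulantTensor μ z d = cumulantTensor μ' z' d := by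
  funext idx
  unfold cumulantTensor
  congr! 4 with π _ B
  have hprod : Measurable fun x : Fin n → ℝ => ∏ k ∈ B, x (idx k) := by fun_prop
  exact (h.comp hprod).integral_eq

theorem cumulantTensor_mem_Vpmi {z : Ω → Fin n → ℝ}
    (h : ∀ i j, i ≠ j → ∀ m < d, ∫ ω, z ω i * z ω j ^ m ∂μ = 0) :
    cumulantTensor μ z d ∈ VpmiSubmodule d n := by
  refine ⟨fun σ idx => jointCumulant_comp_perm (fun k ω => z ω (idx k)) σ, fun k i j hij => ?_⟩
  have hz : (fun l ω => z ω (Function.update (fun _ : Fin d => j) k i l)) =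
      Function.update (fun _ ω => z ω j) k fun ω => z ω i := by
    funext l
    obtain rfl | hl := eq_or_ne l k <;> simp [*]
  rw [cumulantTensor_apply, hz, jointCumulant_update]
  refine Finset.sum_eq_zero fun π _ => mul_eq_zero_of_right _ (mul_eq_zero_of_left ?_ _)
  have hk := π.mem_part (Finset.mem_univ k)
  simp only [Finset.prod_const]
  refine h i j hij _ ?_
  calc ((π.part k).erase k).card < (π.part k).card := Finset.card_erase_lt_of_mem hk
    _ ≤ d := by simpa using (π.part k).card_le_univ

end Cumulants

section MeanIndependence

variable {Ω : Type*} [MeasurableSpace Ω] {μ : Measure Ω} {n d : ℕ} {s : Ω → Fin n → ℝ}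

theorem PairwiseMeanIndep.integral_sub_mul_comp_eq_zero [IsProbabilityMeasure μ]
    (hs : PairwiseMeanIndep μ s) (hm : Measurable s) {i j : Fin n} (hij : i ≠ j) {g : ℝ → ℝ}
    (hg : Measurable g)
    (hint : Integrable (fun ω => (s ω i - ∫ ω', s ω' i ∂μ) * g (s ω j)) μ) :
    ∫ ω, (s ω i - ∫ ω', s ω' i ∂μ) * g (s ω j) ∂μ = 0 := by
  set c := ∫ ω', s ω' i ∂μ
  set m := MeasurableSpace.comap (fun ω => s ω j) inferInstance
  have hle : m ≤ _ := ((measurable_pi_apply j).comp hm).comap_le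
  have hgm : StronglyMeasurable[m] fun ω => g (s ω j) :=
    (hg.comp (comap_measurable fun ω => s ω j)).stronglyMeasurable
  have hcentred : μ[fun ω => s ω i - c | m] =ᵐ[μ] 0 := by
    filter_upwards [condExp_sub (hs.1 i) (integrable_const c) m, hs.2 i j hij] with ω hsub hmean
    exact hsub.trans (by rw [Pi.sub_apply, hmean, condExp_const hle, sub_self, Pi.zero_apply])
  have hpull : μ[(fun ω => s ω i - c) * (fun ω => g (s ω j)) | m] =ᵐ[μ] 0 := by
    filter_upwards [condExp_mul_of_stronglyMeasurable_right hgm hint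
      ((hs.1 i).sub (integrable_const c)), hcentred] with ω hmul hzero
    rw [hmul, Pi.mul_apply, hzero, Pi.zero_apply, zero_mul]
  exact (integral_condExp hle).symm.trans ((integral_congr_ae hpull).trans (by simp))

theorem memLp_standardize [IsFiniteMeasure μ] {p : ENNReal}
    (hs : ∀ i, MemLp (fun ω => s ω i) p μ) (i : Fin n) :
    MemLp (fun ω => standardize μ s ω i) p μ :=
  ((hs i).sub (memLp_const _)).mul_const _

theorem IsPMISource.integral_standardize_mul_pow [IsProbabilityMeasure μ]
    (hs : IsPMISource μ d s) {i j : Fin n} (hij : i ≠ j) {m : ℕ} (hmd : m < d) :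
    ∫ ω, standardize μ s ω i * standardize μ s ω j ^ m ∂μ = 0 := by
  have hint : Integrable (fun ω => standardize μ s ω i * standardize μ s ω j ^ m) μ := by
    have := integrable_prod_of_memLp (B := Finset.univ) (d := d) (by simpa using hmd)
      fun k _ => memLp_standardize hs.memLp ((Fin.cons i fun _ => j : Fin (m + 1) → Fin n) k)
    simpa [Fin.prod_univ_succ] using this
  let g (t : ℝ) := (√(variance (fun ω => s ω i) μ))⁻¹ *
    ((t - ∫ ω, s ω j ∂μ) / √(variance (fun ω => s ω j) μ)) ^ m
  have hg : (fun ω => standardize μ s ω i * standardize μ s ω j ^ m) =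
      fun ω => (s ω i - ∫ ω', s ω' i ∂μ) * g (s ω j) := by
    funext ω
    simp only [g, standardize, div_eq_mul_inv, mul_assoc]
  rw [hg] at hint ⊢
  exact hs.pmi.integral_sub_mul_comp_eq_zero hs.measurable hij (by fun_prop) hint

theorem IsPMISource.cumulantTensor_standardize_mem [IsProbabilityMeasure μ]
    (hs : IsPMISource μ d s) : cumulantTensor μ (standardize μ s) d ∈ VpmiSubmodule d n :=
  cumulantTensor_mem_Vpmi fun _ _ hij _ hm => hs.integral_standardize_mul_pow hij hm

end MeanIndependence

section TensorCoeff

variable {n d : ℕ}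

theorem indexCount_apply (idx : Fin d → Fin n) (i : Fin n) :
    indexCount idx i = Fintype.card {k // idx k = i} := by
  simp [indexCount, Finsupp.single_apply, Fintype.card_subtype]

theorem degree_indexCount (idx : Fin d → Fin n) : (indexCount idx).degree = d := by
  simp [indexCount, map_sum]

theorem exists_comp_perm_eq_of_indexCount_eq {idx idx' : Fin d → Fin n}
    (h : indexCount idx = indexCount idx') : ∃ σ : Equiv.Perm (Fin d), idx' ∘ σ = idx := by
  have e (i : Fin n) : {k // idx k = i} ≃ {k // idx' k = i} :=
    Fintype.equivOfCardEq (by rw [← indexCount_apply, h, indexCount_apply])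
  exact ⟨(Equiv.sigmaFiberEquiv idx).symm.trans
    ((Equiv.sigmaCongrRight e).trans (Equiv.sigmaFiberEquiv idx')),
    funext fun k => (e (idx k) ⟨k, rfl⟩).2⟩

theorem prod_apply_eq_prod_pow {κ M : Type*} [CommMonoid M] (x : Fin n → M) (idx : κ → Fin n)
    (B : Finset κ) :
    ∏ k ∈ B, x (idx k) = ∏ i, x i ^ (∑ k ∈ B, Finsupp.single (idx k) 1) i := by
  have hpow (k : κ) : x (idx k) = ∏ i, x i ^ Finsupp.single (idx k) 1 i := by
    rw [Finset.prod_eq_single (idx k)] <;> simp +contextual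
  simp only [Finsupp.finsetSum_apply, ← Finset.prod_pow_eq_pow_sum]
  rw [Finset.prod_comm]
  exact Finset.prod_congr rfl fun k _ => hpow k

/-- The entries of a symmetric tensor as a function of the exponent of the monomial they belong to,
with value `0` at exponents of a degree other than `d`. -/
noncomputable def tensorCoeff (T : (Fin d → Fin n) → ℝ) : (Fin n →₀ ℕ) → ℝ :=
  Function.extend indexCount T 0

theorem tensorCoeff_smul (c : ℝ) (T : (Fin d → Fin n) → ℝ) (β : Fin n →₀ ℕ) :
    tensorCoeff (c • T) β = c * tensorCoeff T β := by
  have := Function.extend_smul c (indexCount (d := d)) T 0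
  rw [smul_zero] at this
  exact congr_fun this β

theorem tensorCoeff_of_degree_ne (T : (Fin d → Fin n) → ℝ) {β : Fin n →₀ ℕ} (hβ : β.degree ≠ d) :
    tensorCoeff T β = 0 :=
  Function.extend_apply' _ _ _ fun ⟨idx, hidx⟩ => hβ (hidx ▸ degree_indexCount idx)

theorem tensorCoeff_indexCount {T : (Fin d → Fin n) → ℝ} (hT : T ∈ VpmiSubmodule d n)
    (idx : Fin d → Fin n) : tensorCoeff T (indexCount idx) = T idx := by
  have hfactors : Function.FactorsThrough T indexCount := fun _ idx' h => by
    obtain ⟨σ, rfl⟩ := exists_comp_perm_eq_of_indexCount_eq h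
    exact hT.1 σ idx'
  exact hfactors.extend_apply 0 idx

theorem tensorCoeff_eq_zero {T : (Fin d → Fin n) → ℝ} (hT : T ∈ VpmiSubmodule d n)
    {β : Fin n →₀ ℕ} {i j : Fin n} (hij : i ≠ j) (hi : β i = 1)
    (hβ : ∀ k, k ≠ i → k ≠ j → β k = 0) : tensorCoeff T β = 0 := by
  have hβ_eq : β = Finsupp.single i 1 + Finsupp.single j (β j) := by
    ext k
    obtain rfl | hki := eq_or_ne k i
    · simp [hi, hij]
    obtain rfl | hkj := eq_or_ne k j
    · simp [hij]
    · simp [hβ k hki hkj, hki.symm, hkj.symm]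
  obtain hdeg | hdeg := ne_or_eq β.degree d
  · exact tensorCoeff_of_degree_ne T hdeg
  obtain ⟨e, he⟩ : ∃ e, β j = e := ⟨_, rfl⟩
  rw [he] at hβ_eq
  obtain rfl : d = e + 1 := by rw [← hdeg, hβ_eq, map_add]; simp [add_comm]
  rw [hβ_eq, ← indexCount_const e, ← indexCount_cons, tensorCoeff_indexCount hT,
    VpmiSubmodule.apply_cons_const hT hij]

end TensorCoeff

section GridMeasure

variable {n : ℕ} {τ : Type*} [Fintype τ]

/-- The measure with mass `p y` at the grid point with coordinates `g (y i)`. -/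
noncomputable def gridMeasure (g : τ → ℝ) (p : (Fin n → τ) → ℝ) : Measure (Fin n → ℝ) :=
  ∑ y, ENNReal.ofReal (p y) • Measure.dirac fun i => g (y i)

theorem integrable_gridMeasure (g : τ → ℝ) (p : (Fin n → τ) → ℝ) (f : (Fin n → ℝ) → ℝ) :
    Integrable f (gridMeasure g p) := by
  rw [gridMeasure, integrable_finsetSum_measure]
  exact fun y _ => (integrable_dirac (by simp)).smul_measure (by simp)

variable (g : τ → ℝ) {p : (Fin n → τ) → ℝ} (hp : ∀ y, 0 ≤ p y)

include hp

theorem integral_gridMeasure (f : (Fin n → ℝ) → ℝ) :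
    ∫ x, f x ∂gridMeasure g p = ∑ y, p y * f fun i => g (y i) := by
  rw [gridMeasure, integral_finsetSum_measure]
  · refine Finset.sum_congr rfl fun y _ => ?_
    rw [integral_smul_measure, integral_dirac, ENNReal.toReal_ofReal (hp y), smul_eq_mul]
  · exact fun y _ => (integrable_dirac (by simp)).smul_measure (by simp)

theorem isProbabilityMeasure_gridMeasure (hsum : ∑ y, p y = 1) :
    IsProbabilityMeasure (gridMeasure g p) := by
  constructor
  simp only [gridMeasure, Measure.coe_finsetSum, Finset.sum_apply, Measure.smul_apply,
    measure_univ, smul_eq_mul, mul_one]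
  rw [← ENNReal.ofReal_sum_of_nonneg fun y _ => hp y, hsum, ENNReal.ofReal_one]

theorem pairwiseMeanIndep_gridMeasure (hsum : ∑ y, p y = 1)
    (hmean : ∀ i, ∑ y, p y * g (y i) = 0)
    (hpmi : ∀ i j, i ≠ j → ∀ φ : ℝ → ℝ, ∑ y, p y * (g (y i) * φ (g (y j))) = 0) :
    PairwiseMeanIndep (gridMeasure g p) fun y => y := by
  have := isProbabilityMeasure_gridMeasure g hp hsum
  refine ⟨fun i => integrable_gridMeasure g p _, fun i j hij => Filter.EventuallyEq.symm ?_⟩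
  refine ae_eq_condExp_of_forall_setIntegral_eq (measurable_pi_apply j).comap_le
    (integrable_gridMeasure g p _) (fun s _ _ => (integrable_gridMeasure g p _).integrableOn)
    (fun s hs _ => ?_) aestronglyMeasurable_const
  obtain ⟨U, hU, rfl⟩ := hs
  rw [integral_gridMeasure g hp, hmean, integral_zero,
    ← integral_indicator (measurable_pi_apply j hU), integral_gridMeasure g hp,
    ← hpmi i j hij (U.indicator 1)]
  refine Finset.sum_congr rfl fun y _ => ?_
  by_cases hy : g (y j) ∈ U <;> simp [Set.indicator, hy]

end GridMeasure

section MomentGrid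

variable {n d : ℕ}

/-- Nodes on the line whose uniform distribution has mean zero and variance one, together with
signed weights `dual k`, `k ≤ d`, whose moment of order `k` is one and whose other moments of order
at most `d` vanish. -/
structure MomentGrid (d : ℕ) where
  node : Fin (d + 1) → ℝ
  dual : ℕ → Fin (d + 1) → ℝ
  sum_node : ∑ t, node t = 0
  sum_node_sq : ∑ t, node t ^ 2 = d + 1
  sum_dual_mul_node_pow : ∀ k ≤ d, ∀ l ≤ d, ∑ t, dual k t * node t ^ l = if k = l then 1 else 0

theorem exists_injective_sum_eq_zero_sum_sq_eq (hd : d ≠ 0) :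
    ∃ g : Fin (d + 1) → ℝ, Function.Injective g ∧ ∑ t, g t = 0 ∧ ∑ t, g t ^ 2 = d + 1 := by
  set a : ℝ := (∑ t : Fin (d + 1), ((t : ℕ) : ℝ)) / (d + 1) with ha
  let centred (t : Fin (d + 1)) : ℝ := (t : ℕ) - a
  have centred_injective : Function.Injective centred := fun s t h =>
    Fin.ext (by exact_mod_cast sub_left_injective h)
  have hsum : ∑ t, centred t = 0 := by
    simp only [centred, Finset.sum_sub_distrib, Finset.sum_const, Finset.card_univ,
      Fintype.card_fin, nsmul_eq_mul, ha]
    push_cast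
    field_simp
    simp
  have hpos : 0 < ∑ t, centred t ^ 2 := by
    obtain ⟨t, ht⟩ : ∃ t, centred t ≠ 0 := by
      by_contra! h
      have hlast : Fin.last d = 0 := centred_injective ((h _).trans (h 0).symm)
      exact hd (congr_arg Fin.val hlast)
    exact Finset.sum_pos' (fun _ _ => sq_nonneg _) ⟨t, Finset.mem_univ t, by positivity⟩
  set c := √((d + 1) / ∑ t, centred t ^ 2)
  have hc : 0 < c := Real.sqrt_pos.mpr (by positivity)
  refine ⟨fun t => c * centred t, (mul_right_injective₀ hc.ne').comp centred_injective, ?_, ?_⟩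
  · rw [← Finset.mul_sum, hsum, mul_zero]
  · simp only [mul_pow]
    rw [← Finset.mul_sum, Real.sq_sqrt (by positivity), div_mul_cancel₀ _ hpos.ne']

theorem exists_dual_weights {K : Type*} [Field K] {g : Fin (d + 1) → K}
    (hg : Function.Injective g) :
    ∃ q : ℕ → Fin (d + 1) → K,
      ∀ k ≤ d, ∀ l ≤ d, ∑ t, q k t * g t ^ l = if k = l then 1 else 0 := by
  have hdet : IsUnit (Matrix.vandermonde g).det :=
    (Matrix.det_vandermonde_ne_zero_iff.mpr hg).isUnit
  refine ⟨fun k => (Matrix.vandermonde g)⁻¹ (Fin.ofNat (d + 1) k), fun k hk l hl => ?_⟩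
  have h := congr_fun₂ (Matrix.nonsing_inv_mul _ hdet) (Fin.ofNat (d + 1) k)
    (Fin.ofNat (d + 1) l)
  rw [Matrix.mul_apply, Matrix.one_apply] at h
  simpa [Matrix.vandermonde_apply, Fin.ext_iff, Nat.mod_eq_of_lt (Nat.lt_succ_of_le hk),
    Nat.mod_eq_of_lt (Nat.lt_succ_of_le hl)] using h

theorem nonempty_momentGrid (hd : d ≠ 0) : Nonempty (MomentGrid d) := by
  obtain ⟨g, g_injective, hsum, hsq⟩ := exists_injective_sum_eq_zero_sum_sq_eq hd
  obtain ⟨q, hq⟩ := exists_dual_weights g_injective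
  exact ⟨⟨g, q, hsum, hsq, hq⟩⟩

theorem le_of_mem_finsuppAntidiag {ι : Type*} [DecidableEq ι] {s : Finset ι} {β : ι →₀ ℕ}
    (hβ : β ∈ s.finsuppAntidiag d) (i : ι) : β i ≤ d := by
  rw [Finset.mem_finsuppAntidiag'] at hβ
  exact (Finsupp.le_degree i β).trans hβ.1.le

namespace MomentGrid

variable (grid : MomentGrid d) {T : (Fin d → Fin n) → ℝ}

/-- Weights on the `n`-dimensional grid: the uniform ones plus a signed perturbation whose moments
of order `d` are the entries of the symmetric tensor `T` and whose lower moments vanish. -/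
noncomputable def weight (T : (Fin d → Fin n) → ℝ) (y : Fin n → Fin (d + 1)) : ℝ :=
  ∏ _i : Fin n, ((d : ℝ) + 1)⁻¹ +
    ∑ β ∈ Finset.univ.finsuppAntidiag d, tensorCoeff T β * ∏ i, grid.dual (β i) (y i)

theorem sum_weight_mul_prod (T : (Fin d → Fin n) → ℝ) (F : Fin n → Fin (d + 1) → ℝ) :
    ∑ y, grid.weight T y * ∏ i, F i (y i) =
      ∏ i, ((d : ℝ) + 1)⁻¹ * ∑ t, F i t +
        ∑ β ∈ Finset.univ.finsuppAntidiag d, tensorCoeff T β *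
          ∏ i, ∑ t, grid.dual (β i) t * F i t := by
  simp only [weight, add_mul, Finset.sum_add_distrib, Finset.sum_mul, Finset.mul_sum,
    Fintype.prod_sum, Finset.prod_mul_distrib]
  rw [Finset.sum_comm]
  simp only [mul_assoc]

theorem sum_weight_mul_monomial (T : (Fin d → Fin n) → ℝ) {γ : Fin n →₀ ℕ} (hγ : γ.degree ≤ d) :
    ∑ y, grid.weight T y * ∏ i, grid.node (y i) ^ γ i =
      (∏ i, ((d : ℝ) + 1)⁻¹ * ∑ t, grid.node t ^ γ i) + tensorCoeff T γ := by
  rw [grid.sum_weight_mul_prod T fun i t => grid.node t ^ γ i, add_right_inj]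
  have hterm : ∀ β ∈ Finset.univ.finsuppAntidiag d, tensorCoeff T β *
      ∏ i, ∑ t, grid.dual (β i) t * grid.node t ^ γ i = if β = γ then tensorCoeff T β else 0 :=
    fun β hβ => by
      simp only [fun i => grid.sum_dual_mul_node_pow _ (le_of_mem_finsuppAntidiag hβ i) _
        ((Finsupp.le_degree i γ).trans hγ), Finset.prod_ite_zero, Finset.prod_const_one,
        Finset.mem_univ, true_imp_iff, DFunLike.ext_iff, mul_ite, mul_one, mul_zero]
  rw [Finset.sum_congr rfl hterm, Finset.sum_ite_eq', ite_eq_left_iff]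
  intro hγ_antidiag
  refine (tensorCoeff_of_degree_ne T fun h => hγ_antidiag ?_).symm
  simpa [Finsupp.degree_eq_sum] using h

theorem sum_weight_mul_monomial_of_lt (T : (Fin d → Fin n) → ℝ) {γ : Fin n →₀ ℕ}
    (hγ : γ.degree < d) :
    ∑ y, grid.weight T y * ∏ i, grid.node (y i) ^ γ i =
      ∏ i, ((d : ℝ) + 1)⁻¹ * ∑ t, grid.node t ^ γ i := by
  rw [grid.sum_weight_mul_monomial T hγ.le, tensorCoeff_of_degree_ne T hγ.ne, add_zero]

theorem inv_mul_sum_one : ((d : ℝ) + 1)⁻¹ * ∑ _t : Fin (d + 1), (1 : ℝ) = 1 := by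
  have : (d : ℝ) + 1 ≠ 0 := by positivity
  simp [this]

theorem sum_weight (hd : d ≠ 0) (T : (Fin d → Fin n) → ℝ) : ∑ y, grid.weight T y = 1 := by
  have h := grid.sum_weight_mul_monomial_of_lt T (γ := 0) (by simpa using Nat.pos_of_ne_zero hd)
  simpa only [Finsupp.coe_zero, Pi.zero_apply, pow_zero, Finset.prod_const_one, mul_one,
    inv_mul_sum_one] using h

theorem sum_weight_mul_node_pow (T : (Fin d → Fin n) → ℝ) (i : Fin n) {m : ℕ} (hm : m < d) :
    ∑ y, grid.weight T y * grid.node (y i) ^ m =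
      ((d : ℝ) + 1)⁻¹ * ∑ t, grid.node t ^ m := by
  have h := grid.sum_weight_mul_monomial_of_lt T (γ := Finsupp.single i m) (by simpa using hm)
  rw [Finset.prod_eq_single i (fun k _ hk => by
    simp only [Finsupp.single_eq_of_ne hk, pow_zero, inv_mul_sum_one]) (by simp)] at h
  convert h using 3 with y
  · rw [Finset.prod_eq_single i] <;> simp +contextual
  · simp

theorem sum_weight_mul_node_mul (hd : d ≠ 0) (hT : T ∈ VpmiSubmodule d n) {i j : Fin n}
    (hij : i ≠ j) (φ : ℝ → ℝ) :
    ∑ y, grid.weight T y * (grid.node (y i) * φ (grid.node (y j))) = 0 := by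
  let F : Fin n → Fin (d + 1) → ℝ := Pi.mulSingle i grid.node * Pi.mulSingle j (φ ∘ grid.node)
  have hFi : F i = grid.node := by simp [F, hij]
  have hF (k : Fin n) (hki : k ≠ i) (hkj : k ≠ j) : F k = 1 := by simp [F, hki, hkj]
  have hprod (y : Fin n → Fin (d + 1)) :
      grid.node (y i) * φ (grid.node (y j)) = ∏ k, F k (y k) := by
    simp only [F, Pi.mul_apply, Finset.prod_mul_distrib]
    rw [Finset.prod_eq_single i, Finset.prod_eq_single j] <;> simp +contextual
  simp only [hprod]
  rw [grid.sum_weight_mul_prod,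
    Finset.prod_eq_zero (Finset.mem_univ i) (by rw [hFi, grid.sum_node, mul_zero]), zero_add]
  refine Finset.sum_eq_zero fun β hβ => mul_eq_zero.mpr ?_
  by_cases hi : β i = 1
  · by_cases hk : ∀ k, k ≠ i → k ≠ j → β k = 0
    · exact .inl (tensorCoeff_eq_zero hT hij hi hk)
    push Not at hk
    obtain ⟨k, hki, hkj, hk⟩ := hk
    have := grid.sum_dual_mul_node_pow _ (le_of_mem_finsuppAntidiag hβ k) 0 d.zero_le
    exact .inr (Finset.prod_eq_zero (Finset.mem_univ k)
      (by simpa only [hF k hki hkj, pow_zero, hk, if_false, Pi.one_apply] using this))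
  · have := grid.sum_dual_mul_node_pow _ (le_of_mem_finsuppAntidiag hβ i) 1
      (Nat.one_le_iff_ne_zero.mpr hd)
    exact .inr (Finset.prod_eq_zero (Finset.mem_univ i)
      (by simpa only [hFi, pow_one, hi, if_false] using this))

theorem weight_smul (c : ℝ) (T : (Fin d → Fin n) → ℝ) (y : Fin n → Fin (d + 1)) :
    grid.weight (c • T) y = ∏ _i : Fin n, ((d : ℝ) + 1)⁻¹ +
      c * ∑ β ∈ Finset.univ.finsuppAntidiag d, tensorCoeff T β * ∏ i, grid.dual (β i) (y i) := by
  simp only [weight, tensorCoeff_smul, mul_assoc, Finset.mul_sum]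

theorem weight_zero_pos (y : Fin n → Fin (d + 1)) : 0 < grid.weight 0 y := by
  have := grid.weight_smul 0 0 y
  rw [zero_smul, zero_mul, add_zero] at this
  rw [this]
  positivity

theorem eventually_weight_smul_pos (T : (Fin d → Fin n) → ℝ) :
    ∀ᶠ t in nhds (0 : ℝ), ∀ y, 0 < grid.weight (t • T) y := by
  refine Filter.eventually_all.mpr fun y => ?_
  have hcont : Continuous fun t : ℝ => grid.weight (t • T) y := by
    simp only [weight_smul]
    fun_prop
  exact hcont.continuousAt.eventually (lt_mem_nhds (by simpa using grid.weight_zero_pos y))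

section Source

variable (hpos : ∀ y, 0 ≤ grid.weight T y)

include hpos

theorem integral_apply_eq_zero (hd : 1 < d) (i : Fin n) :
    ∫ x, x i ∂gridMeasure grid.node (grid.weight T) = 0 := by
  have := grid.sum_weight_mul_node_pow T i hd
  simp only [pow_one] at this
  rw [integral_gridMeasure _ hpos, this, grid.sum_node, mul_zero]

theorem variance_apply_eq_one (hd : 2 < d) (i : Fin n) :
    variance (fun x => x i) (gridMeasure grid.node (grid.weight T)) = 1 := by
  have hd0 : (d : ℝ) + 1 ≠ 0 := by positivity
  rw [variance_of_integral_eq_zero (measurable_pi_apply i).aemeasurable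
    (grid.integral_apply_eq_zero hpos (by lia) i), integral_gridMeasure _ hpos]
  exact (grid.sum_weight_mul_node_pow T i hd).trans (by rw [grid.sum_node_sq, inv_mul_cancel₀ hd0])

theorem standardize_gridMeasure (hd : 2 < d) :
    standardize (gridMeasure grid.node (grid.weight T)) (fun x => x) = fun x => x := by
  funext x i
  simp [standardize, grid.integral_apply_eq_zero hpos (by lia), grid.variance_apply_eq_one hpos hd]

theorem isPMISource_gridMeasure (hd : 2 < d) (hT : T ∈ VpmiSubmodule d n) :
    IsPMISource (gridMeasure grid.node (grid.weight T)) d fun x => x where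
  measurable := measurable_id
  pmi := pairwiseMeanIndep_gridMeasure _ hpos (grid.sum_weight (by lia) T)
    (fun i => (integral_gridMeasure _ hpos _).symm.trans
      (grid.integral_apply_eq_zero hpos (by lia) i))
    fun _ _ hij φ => grid.sum_weight_mul_node_mul (by lia) hT hij φ
  memLp i := by
    rw [← integrable_norm_rpow_iff (measurable_pi_apply i).aestronglyMeasurable
      (by exact_mod_cast (by lia : d ≠ 0)) (by simp)]
    exact integrable_gridMeasure _ _ _
  variance_ne_zero i := by
    rw [grid.variance_apply_eq_one hpos hd]
    exact one_ne_zero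

theorem integral_prod_gridMeasure (idx : Fin d → Fin n) (B : Finset (Fin d)) :
    ∫ x, ∏ k ∈ B, x (idx k) ∂gridMeasure grid.node (grid.weight T) =
      (∏ i, ((d : ℝ) + 1)⁻¹ * ∑ t, grid.node t ^ (∑ k ∈ B, Finsupp.single (idx k) 1) i) +
        tensorCoeff T (∑ k ∈ B, Finsupp.single (idx k) 1) := by
  have hdeg : (∑ k ∈ B, Finsupp.single (idx k) 1 : Fin n →₀ ℕ).degree = B.card := by
    simp [map_sum]
  rw [integral_gridMeasure _ hpos, ← grid.sum_weight_mul_monomial T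
    (hdeg.trans_le (by simpa using B.card_le_univ))]
  simp only [fun y : Fin n → Fin (d + 1) => prod_apply_eq_prod_pow (fun i => grid.node (y i)) idx B]

theorem cumulantTensor_gridMeasure (hd : d ≠ 0) (hT : T ∈ VpmiSubmodule d n) :
    cumulantTensor (gridMeasure grid.node (grid.weight T)) (fun x => x) d =
      cumulantTensor (gridMeasure grid.node (grid.weight (n := n) 0)) (fun x => x) d + T := by
  have : Nonempty (Fin d) := Fin.pos_iff_nonempty.mp (Nat.pos_of_ne_zero hd)
  have hpos_zero (y) : 0 ≤ grid.weight (n := n) 0 y := (grid.weight_zero_pos y).le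
  ext idx
  have hmoments : ∀ B ≠ (Finset.univ : Finset (Fin d)),
      ∫ x, ∏ k ∈ B, x (idx k) ∂gridMeasure grid.node (grid.weight T) =
        ∫ x, ∏ k ∈ B, x (idx k) ∂gridMeasure grid.node (grid.weight 0) := fun B hB => by
    have hdeg : (∑ k ∈ B, Finsupp.single (idx k) 1 : Fin n →₀ ℕ).degree ≠ d := by
      simpa [map_sum] using (Finset.card_lt_card (Finset.ssubset_univ_iff.mpr hB)).ne
    rw [grid.integral_prod_gridMeasure hpos, grid.integral_prod_gridMeasure hpos_zero,
      tensorCoeff_of_degree_ne _ hdeg, tensorCoeff_of_degree_ne _ hdeg]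
  rw [Pi.add_apply, ← sub_eq_iff_eq_add', cumulantTensor_apply, cumulantTensor_apply,
    jointCumulant_sub_of_moments_eq hmoments, grid.integral_prod_gridMeasure hpos,
    grid.integral_prod_gridMeasure hpos_zero, add_sub_add_left_eq_sub]
  exact (congr_arg₂ _ (tensorCoeff_indexCount hT idx)
    (tensorCoeff_indexCount (Submodule.zero_mem _) idx)).trans (sub_zero _)

end Source

end MomentGrid

theorem exists_isPMISource_eval_cumulantTensor_ne_zero (hd : 2 < d)
    {P : MvPolynomial (Fin d → Fin n) ℝ} {T : (Fin d → Fin n) → ℝ} (hT : T ∈ VpmiSubmodule d n)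
    (hP : MvPolynomial.eval T P ≠ 0) :
    ∃ ν : Measure (Fin n → ℝ), IsProbabilityMeasure ν ∧ IsPMISource ν d (fun x => x) ∧
      MvPolynomial.eval (cumulantTensor ν (standardize ν fun x => x) d) P ≠ 0 := by
  obtain ⟨grid⟩ := nonempty_momentGrid (d := d) (by lia)
  have hprob {S : (Fin d → Fin n) → ℝ} (hpos : ∀ y, 0 ≤ grid.weight S y) :=
    isProbabilityMeasure_gridMeasure grid.node hpos (grid.sum_weight (by lia) S)
  have hpos_zero (y) : 0 ≤ grid.weight (n := n) 0 y := (grid.weight_zero_pos y).le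
  set κ₀ := cumulantTensor (gridMeasure grid.node (grid.weight (n := n) 0)) (fun x => x) d with hκ₀
  have hκ₀_mem : κ₀ ∈ VpmiSubmodule d n := by
    have := hprob hpos_zero
    have hsource := grid.isPMISource_gridMeasure hpos_zero hd (Submodule.zero_mem _)
    rw [hκ₀, ← grid.standardize_gridMeasure hpos_zero hd]
    exact hsource.cumulantTensor_standardize_mem
  obtain ⟨Q, hQ⟩ := exists_polynomial_eval_lineMap P κ₀ T
  have hQ_ne : Q ≠ 0 := by
    rintro rfl
    exact hP (by simpa using (hQ 1).symm)
  have hroot : ∀ᶠ t in nhdsWithin (0 : ℝ) {0}ᶜ, Q.eval t ≠ 0 :=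
    nhdsNE_le_cofinite (0 : ℝ) (Polynomial.finite_setOfPred_isRoot hQ_ne).compl_mem_cofinite
  obtain ⟨t, ht_root, ht_pos⟩ := (hroot.and
    ((grid.eventually_weight_smul_pos (T - κ₀)).filter_mono nhdsWithin_le_nhds)).exists
  have hpos (y) := (ht_pos y).le
  have hmem : t • (T - κ₀) ∈ VpmiSubmodule d n :=
    Submodule.smul_mem _ _ (Submodule.sub_mem _ hT hκ₀_mem)
  refine ⟨_, hprob hpos, grid.isPMISource_gridMeasure hpos hd hmem, ?_⟩
  rw [grid.standardize_gridMeasure hpos hd, grid.cumulantTensor_gridMeasure hpos (by lia) hmem,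
    ← hκ₀, add_comm]
  simpa [hQ, AffineMap.lineMap_apply] using ht_root

end MomentGrid

section Identification

variable {Ω Ω' : Type*} [MeasurableSpace Ω] [MeasurableSpace Ω'] {μ : Measure Ω} {μ' : Measure Ω'}
  {n d : ℕ} {s : Ω → Fin n → ℝ} {s' : Ω' → Fin n → ℝ} {M : Matrix (Fin n) (Fin n) ℝ}

theorem measurable_mulVec (M : Matrix (Fin n) (Fin n) ℝ) : Measurable M.mulVec :=
  (continuous_const.matrix_mulVec continuous_id).measurable

theorem identDistrib_inv_mul_mulVec {A B : Matrix (Fin n) (Fin n) ℝ} (hB : IsUnit B.det)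
    (h : IdentDistrib (fun ω => A.mulVec (s ω)) (fun ω => B.mulVec (s' ω)) μ μ') :
    IdentDistrib (fun ω => (B⁻¹ * A).mulVec (s ω)) s' μ μ' := by
  have := h.comp (measurable_mulVec B⁻¹)
  simpa only [Function.comp_def, Matrix.mulVec_mulVec, Matrix.nonsing_inv_mul B hB,
    Matrix.one_mulVec] using this

section Covariance

theorem IsPMISource.variance_pos (hs : IsPMISource μ d s) (i : Fin n) :
    0 < variance (fun ω => s ω i) μ :=
  (variance_nonneg _ _).lt_of_ne' (hs.variance_ne_zero i)

theorem IsPMISource.memLp_two [IsFiniteMeasure μ] (hs : IsPMISource μ d s) (hd : 2 ≤ d)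
    (i : Fin n) : MemLp (fun ω => s ω i) 2 μ :=
  (hs.memLp i).mono_exponent (by exact_mod_cast hd)

theorem covariance_mulVec [IsFiniteMeasure μ] {m : ℕ} {z : Ω → Fin n → ℝ}
    (hz : ∀ i, MemLp (fun ω => z ω i) 2 μ)
    (hcov : ∀ i j, i ≠ j → cov[fun ω => z ω i, fun ω => z ω j; μ] = 0)
    (M : Matrix (Fin m) (Fin n) ℝ) (i k : Fin m) :
    cov[fun ω => M.mulVec (z ω) i, fun ω => M.mulVec (z ω) k; μ] =
      ∑ j, M i j * M k j * variance (fun ω => z ω j) μ := by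
  simp only [Matrix.mulVec, dotProduct]
  rw [covariance_fun_sum_fun_sum (fun j => (hz j).const_mul _) fun j => (hz j).const_mul _]
  simp only [covariance_const_mul_left, covariance_const_mul_right]
  refine Finset.sum_congr rfl fun j _ => ?_
  rw [Finset.sum_eq_single j (fun l _ hl => by rw [hcov j l hl.symm]; ring) (by simp),
    covariance_self (hz j).aemeasurable]
  ring

variable [IsProbabilityMeasure μ]

theorem IsPMISource.covariance_eq_zero (hs : IsPMISource μ d s) (hd : 2 ≤ d) {i j : Fin n}
    (hij : i ≠ j) : cov[fun ω => s ω i, fun ω => s ω j; μ] = 0 :=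
  hs.pmi.integral_sub_mul_comp_eq_zero hs.measurable hij (g := (· - ∫ ω, s ω j ∂μ)) (by fun_prop)
    (((hs.memLp_two hd i).sub (memLp_const _)).integrable_mul
      ((hs.memLp_two hd j).sub (memLp_const _)))

theorem IsPMISource.covariance_standardize (hs : IsPMISource μ d s) (hd : 2 ≤ d) (i j : Fin n) :
    cov[fun ω => standardize μ s ω i, fun ω => standardize μ s ω j; μ] =
      (1 : Matrix (Fin n) (Fin n) ℝ) i j := by
  unfold standardize
  rw [covariance_fun_div_left, covariance_fun_div_right, covariance_sub_const_left (hs.pmi.1 i),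
    covariance_sub_const_right (hs.pmi.1 j)]
  obtain rfl | hij := eq_or_ne i j
  · rw [covariance_self (hs.memLp i).aemeasurable, Matrix.one_apply_eq, div_div,
      Real.mul_self_sqrt (hs.variance_pos i).le, div_self (hs.variance_ne_zero i)]
  · rw [hs.covariance_eq_zero hd hij, zero_div, zero_div, Matrix.one_apply_ne hij]

end Covariance

theorem covariance_eq_of_identDistrib (h : IdentDistrib s s' μ μ') (i j : Fin n) :
    cov[fun ω => s ω i, fun ω => s ω j; μ] = cov[fun ω => s' ω i, fun ω => s' ω j; μ'] := by
  have hproj (k : Fin n) (ν : Measure (Fin n → ℝ)) :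
      AEStronglyMeasurable (fun x : Fin n → ℝ => x k) ν :=
    (measurable_pi_apply k).aestronglyMeasurable
  rw [← covariance_map_fun (hproj i _) (hproj j _) h.aemeasurable_fst, h.map_eq,
    covariance_map_fun (hproj i _) (hproj j _) h.aemeasurable_snd]

/-- The matrix that mixes `standardize μ s` into `standardize μ' s'` when `M` mixes `s` into `s'`:
the columns of `M` are multiplied by the standard deviations of `s`, and its rows are divided by
those of `s'`. -/
noncomputable def standardizedMixing (μ : Measure Ω) (s : Ω → Fin n → ℝ) (μ' : Measure Ω')
    (s' : Ω' → Fin n → ℝ) (M : Matrix (Fin n) (Fin n) ℝ) : Matrix (Fin n) (Fin n) ℝ :=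
  Matrix.of fun i j => M i j * √(variance (fun ω => s ω j) μ) / √(variance (fun ω => s' ω i) μ')

theorem standardizedMixing_ne_zero (hs : IsPMISource μ d s) (hs' : IsPMISource μ' d s')
    {i j : Fin n} (h : M i j ≠ 0) : standardizedMixing μ s μ' s' M i j ≠ 0 :=
  div_ne_zero (mul_ne_zero h (Real.sqrt_pos.mpr (hs.variance_pos j)).ne')
    (Real.sqrt_pos.mpr (hs'.variance_pos i)).ne'

theorem identDistrib_standardizedMixing_mulVec (hs : IsPMISource μ d s)
    (h : IdentDistrib (fun ω => M.mulVec (s ω)) s' μ μ') :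
    IdentDistrib (fun ω => (standardizedMixing μ s μ' s' M).mulVec (standardize μ s ω))
      (standardize μ' s') μ μ' := by
  have hmean (i : Fin n) : ∫ ω, s' ω i ∂μ' = ∑ j, M i j * ∫ ω, s ω j ∂μ := by
    refine (h.comp (measurable_pi_apply i)).integral_eq.symm.trans ?_
    simp only [Function.comp_def, Matrix.mulVec, dotProduct]
    rw [integral_finsetSum _ fun j _ => (hs.pmi.1 j).const_mul _]
    simp only [integral_const_mul]
  have hstd : Measurable fun (x : Fin n → ℝ) i =>
      (x i - ∫ ω, s' ω i ∂μ') / √(variance (fun ω => s' ω i) μ') := by fun_prop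
  convert h.comp hstd using 1
  swap; · rfl
  funext ω i
  simp only [Function.comp_def, hmean, Matrix.mulVec, dotProduct, ← Finset.sum_sub_distrib,
    Finset.sum_div, standardizedMixing, standardize, Matrix.of_apply]
  refine Finset.sum_congr rfl fun j _ => ?_
  have := (Real.sqrt_pos.mpr (hs.variance_pos j)).ne'
  field_simp

variable [IsProbabilityMeasure μ]

theorem IsPMISource.of_identDistrib_mulVec (hs : IsPMISource μ d s) (hd : 2 ≤ d)
    (hm' : Measurable s') (hs' : PairwiseMeanIndep μ' s') (hM : M.det ≠ 0)
    (h : IdentDistrib (fun ω => M.mulVec (s ω)) s' μ μ') : IsPMISource μ' d s' where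
  measurable := hm'
  pmi := hs'
  memLp i := by
    have : MemLp (fun ω => M.mulVec (s ω) i) d μ :=
      memLp_finsetSum Finset.univ fun j _ => (hs.memLp j).const_mul (M i j)
    exact (h.comp (measurable_pi_apply i)).memLp_snd this
  variance_ne_zero i := fun h0 => by
    rw [← covariance_self (X := fun ω => s' ω i) (by fun_prop),
      ← covariance_eq_of_identDistrib h, covariance_mulVec (hs.memLp_two hd)
        fun _ _ => hs.covariance_eq_zero hd, Finset.sum_eq_zero_iff_of_nonneg
        fun j _ => mul_nonneg (mul_self_nonneg _) (variance_nonneg _ _)] at h0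
    refine hM (Matrix.det_eq_zero_of_row_eq_zero i fun j => ?_)
    exact mul_self_eq_zero.mp
      ((mul_eq_zero.mp (h0 j (Finset.mem_univ j))).resolve_right (hs.variance_ne_zero j))

variable [IsProbabilityMeasure μ']

theorem standardizedMixing_mul_transpose (hs : IsPMISource μ d s) (hs' : IsPMISource μ' d s')
    (hd : 2 ≤ d) (h : IdentDistrib (fun ω => M.mulVec (s ω)) s' μ μ') :
    standardizedMixing μ s μ' s' M * (standardizedMixing μ s μ' s' M).transpose = 1 := by
  ext i k
  have hz (j : Fin n) : MemLp (fun ω => standardize μ s ω j) 2 μ :=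
    memLp_standardize (hs.memLp_two hd) j
  rw [← hs'.covariance_standardize hd,
    ← covariance_eq_of_identDistrib (identDistrib_standardizedMixing_mulVec hs h),
    covariance_mulVec hz fun i j hij => by
      rw [hs.covariance_standardize hd, Matrix.one_apply_ne hij]]
  simp only [← covariance_self (hz _).aemeasurable, hs.covariance_standardize hd,
    Matrix.one_apply_eq, mul_one]
  rfl

theorem isTensorEigenvector_standardizedMixing (hs : IsPMISource μ (d + 1) s)
    (hs' : IsPMISource μ' (d + 1) s') (hd : 1 ≤ d)
    (h : IdentDistrib (fun ω => M.mulVec (s ω)) s' μ μ') (j : Fin n) :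
    IsTensorEigenvector (cumulantTensor μ (standardize μ s) (d + 1))
      (standardizedMixing μ s μ' s' M j) := by
  refine isTensorEigenvector_row_of_dotProduct_eq_zero
    (standardizedMixing_mul_transpose hs hs' (by lia) h) fun i hij => ?_
  rw [dotProduct_contractPow_cumulantTensor (memLp_standardize hs.memLp),
    cumulantTensor_eq_of_identDistrib (identDistrib_standardizedMixing_mulVec hs h)]
  exact VpmiSubmodule.apply_cons_const hs'.cumulantTensor_standardize_mem hij

theorem exists_perm_scaling_of_mul_eq {K ι : Type*} [Field K] [Fintype ι] [DecidableEq ι]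
    {A B M : Matrix ι ι K} (hBM : B * M = A) (hM : M.det ≠ 0)
    (hrow : ∀ i a b, M i a ≠ 0 → M i b ≠ 0 → a = b) :
    ∃ (σ : Equiv.Perm ι) (c : ι → K), (∀ j, c j ≠ 0) ∧ ∀ i j, B i (σ j) = c j * A i j := by
  have hcol (j : ι) : ∃ i, M i j ≠ 0 := by
    contrapose! hM
    exact Matrix.det_eq_zero_of_column_eq_zero j hM
  choose f hf using hcol
  have f_injective : Function.Injective f := fun a b hab => hrow (f a) a b (hf a) (hab ▸ hf b)
  let σ := Equiv.ofBijective f (Finite.injective_iff_bijective.mp f_injective)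
  refine ⟨σ, fun j => (M (σ j) j)⁻¹, fun j => inv_ne_zero (hf j), fun i j => ?_⟩
  have hA : A i j = B i (σ j) * M (σ j) j := by
    rw [← hBM, Matrix.mul_apply]
    refine Finset.sum_eq_single _ (fun k _ hk => mul_eq_zero_of_right _ ?_) (by simp)
    obtain ⟨a, rfl⟩ := σ.surjective k
    by_contra hne
    exact hk (congr_arg σ (hrow (σ a) a j (hf a) hne))
  have hσ : M (σ j) j ≠ 0 := hf j
  rw [hA]
  field_simp

end Identification

theorem theorem1p2 (n d : ℕ) (hd : 3 ≤ d) :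
    ∃ P : MvPolynomial (Fin d → Fin n) ℝ,
      -- the condition `P ≠ 0` is generic on the tensors in `V_pmi` ...
      (∃ T ∈ Vpmi d n, MvPolynomial.eval T P ≠ 0) ∧
      -- ... and it holds for some pairwise mean independent source distribution
      (∃ ν : Measure (Fin n → ℝ), IsProbabilityMeasure ν ∧ IsPMISource ν d (fun y => y) ∧
        MvPolynomial.eval (cumulantTensor ν (standardize ν (fun y => y)) d) P ≠ 0) ∧
      -- identifiability of the mixing matrix from the distribution of `A s`
      ∀ {Ω : Type*} [MeasurableSpace Ω] (μ : Measure Ω) [IsProbabilityMeasure μ]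
        (s : Ω → Fin n → ℝ) (A : Matrix (Fin n) (Fin n) ℝ),
        IsPMISource μ d s → IsUnit A.det →
        MvPolynomial.eval (cumulantTensor μ (standardize μ s) d) P ≠ 0 →
        ∀ {Ω' : Type*} [MeasurableSpace Ω'] (μ' : Measure Ω') [IsProbabilityMeasure μ']
          (s' : Ω' → Fin n → ℝ) (B : Matrix (Fin n) (Fin n) ℝ),
          Measurable s' → PairwiseMeanIndep μ' s' → IsUnit B.det →
          μ'.map (fun ω => B.mulVec (s' ω)) = μ.map (fun ω => A.mulVec (s ω)) →
          ∃ (σ : Equiv.Perm (Fin n)) (c : Fin n → ℝ),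
            (∀ j, c j ≠ 0) ∧ ∀ i j, B i (σ j) = c j * A i j := by
  obtain ⟨e, rfl⟩ : ∃ e, d = e + 1 := ⟨d - 1, by lia⟩
  obtain ⟨P, ⟨T, hT, hTP⟩, hP⟩ := eventually_hasOnlyStandardEigenbases (n := n) (e := e) (by lia)
  refine ⟨P, ⟨T, hT, hTP⟩, exists_isPMISource_eval_cumulantTensor_ne_zero hd hT hTP, ?_⟩
  intro Ω _ μ _ s A hs hA hPs Ω' _ μ' _ s' B hm' hs' hB hmap
  have hlaw : IdentDistrib (fun ω => (B⁻¹ * A).mulVec (s ω)) s' μ μ' :=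
    identDistrib_inv_mul_mulVec hB ⟨((measurable_mulVec A).comp hs.measurable).aemeasurable,
      ((measurable_mulVec B).comp hm').aemeasurable, hmap.symm⟩
  have hdet : (B⁻¹ * A).det ≠ 0 := by
    rw [Matrix.det_mul]
    exact mul_ne_zero (Matrix.isUnit_nonsing_inv_det B hB).ne_zero hA.ne_zero
  have hsource : IsPMISource μ' (e + 1) s' := hs.of_identDistrib_mulVec (by lia) hm' hs' hdet hlaw
  have hrow := hP _ hs.cumulantTensor_standardize_mem hPs _
    (standardizedMixing_mul_transpose hs hsource (by lia) hlaw)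
    (isTensorEigenvector_standardizedMixing hs hsource (by lia) hlaw)
  exact exists_perm_scaling_of_mul_eq (Matrix.mul_nonsing_inv_cancel_left B A hB) hdet
    fun i a b ha hb => hrow i a b (standardizedMixing_ne_zero hs hsource ha)
      (standardizedMixing_ne_zero hs hsource hb)
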